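/- Let $\mathsf P_{X,Y}$ be a probability measure on a product $\mathcal X\times\mathcal Y$ of measurable spaces, with marginals $\mathsf P_X,\mathsf P_Y$, such that $\mathsf P_{X,Y}\ll \mathsf P_X\otimes\mathsf P_Y$ and the likelihood ratio $L=\frac{d\mathsf P_{X,Y}}{d(\mathsf P_X\otimes \mathsf P_Y)}$ belongs to $L_2(\mathsf P_X\otimes\mathsf P_Y)$. Let $\mathcal L:L_2(\mathsf P_Y)\to L_2(\mathsf P_X)$ be the Hilbert--Schmidt operator $(\mathcal L h)(x)=\int L(x,y)h(y)\,d\mathsf P_Y(y)$, and let $\lambda_0\ge\lambda_1\ge\cdots\ge 0$ be its singular values, i.e. the square roots of the eigenvalues of $\mathcal L^*\mathcal L$ counted with multiplicity, continued by zeros if only finitely many are positive. Let $0\le m\le n$ be integers and let $S_{m,n}$ be the set of injections $[m]\to[n]$. Let $\mathbb P_0=\mathsf P_X^{\otimes n}\otimes\mathsf P_Y^{\otimes m}$ be the law of $(X_1,\dots,X_n,Y_1,\dots,Y_m)$ under the null hypothesis. Let $\mathbb P_1=\frac1{|S_{m,n}|}\sum_{\pi\in S_{m,n}}\mathbb P_{1|\pi}$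 be its law under the alternative, where under $\mathbb P_{1|\pi}$ the pairs $(X_{\pi(i)},Y_i)$, $i\in[m]$, are i.i.d. with law $\mathsf P_{X,Y}$ and, independently of them, the $X_j$ with $j\in[n]\setminus\pi([m])$ are i.i.d. with law $\mathsf P_X$. Then $\mathbb P_1\ll\mathbb P_0$, the likelihood ratio $\mathbf L=\frac{d\mathbb P_1}{d\mathbb P_0}$ is in $L_2(\mathbb P_0)$, and $$\mathbb E_{\mathbb P_0}[\mathbf L^2]=\sum_{\ell=0}^m t_\ell a_\ell ,\qquad t_\ell=\binom{n-\ell-1}{m-\ell}\Big/\binom nm ,\qquad \sum_{\ell=0}^m t_\ell=1,$$ where $\binom{-1}{0}=1$, and $a_\ell$ is the $\ell$-th coefficient of the power series $\prod_{k=0}^\infty\frac1{1-z\lambda_k^2}$, an infinite product that converges coefficientwise. -/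

import Mathlib

open MeasureTheory
open scoped ENNReal PowerSeries.WithPiTopology

noncomputable section

namespace BrokenSample

/-! ### Integral operators with a square-integrable kernel -/

section KernelOperator

variable {α β : Type*} [MeasurableSpace α] [MeasurableSpace β]
  {μ : Measure α} {ν : Measure β} [SFinite ν]

lemma lintegral_sq_enorm {γ : Type*} [MeasurableSpace γ] {ρ : Measure γ} {f : γ → ℝ} :
    ∫⁻ z, ‖f z‖ₑ ^ (2 : ℝ) ∂ρ = eLpNorm f 2 ρ ^ (2 : ℝ) := by
  rw [eLpNorm_eq_lintegral_rpow_enorm_toReal (by simp) (by simp)]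
  rw [← ENNReal.rpow_mul]
  simp

lemma kernel_section_memLp {K : α × β → ℝ} (hKm : StronglyMeasurable K)
    (hK : MemLp K 2 (μ.prod ν)) :
    ∀ᵐ x ∂μ, MemLp (fun y => K (x, y)) 2 ν := by
  have hfin : ∫⁻ x, ∫⁻ y, ‖K (x, y)‖ₑ ^ (2 : ℝ) ∂ν ∂μ ≠ ∞ := by
    rw [← lintegral_prod (fun z => ‖K z‖ₑ ^ (2 : ℝ)) (by have := hKm.measurable; fun_prop),
      lintegral_sq_enorm]
    exact ENNReal.rpow_ne_top_of_nonneg (by norm_num) hK.eLpNorm_ne_top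
  have hmeas : Measurable fun x => ∫⁻ y, ‖K (x, y)‖ₑ ^ (2 : ℝ) ∂ν :=
    Measurable.lintegral_prod_right' (f := fun z => ‖K z‖ₑ ^ (2 : ℝ))
      (by have := hKm.measurable; fun_prop)
  filter_upwards [ae_lt_top hmeas hfin] with x hx
  refine ⟨(hKm.comp_measurable measurable_prodMk_left).aestronglyMeasurable, ?_⟩
  rw [eLpNorm_eq_lintegral_rpow_enorm_toReal (by simp) (by simp)]
  exact ENNReal.rpow_lt_top_of_nonneg (by norm_num) (by simpa using hx.ne)

lemma kernel_eLpNorm_le {K : α × β → ℝ} (hKm : StronglyMeasurable K)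
    {h : β → ℝ} (hh : AEStronglyMeasurable h ν) :
    eLpNorm (fun x => ∫ y, K (x, y) * h y ∂ν) 2 μ ≤ eLpNorm K 2 (μ.prod ν) * eLpNorm h 2 ν := by
  have hpt : ∀ x, ‖∫ y, K (x, y) * h y ∂ν‖ₑ ^ (2 : ℝ) ≤
      (∫⁻ y, ‖K (x, y)‖ₑ ^ (2 : ℝ) ∂ν) * ∫⁻ y, ‖h y‖ₑ ^ (2 : ℝ) ∂ν := by
    intro x
    have h1 : ‖∫ y, K (x, y) * h y ∂ν‖ₑ ≤ ∫⁻ y, ‖K (x, y)‖ₑ * ‖h y‖ₑ ∂ν := by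
      simpa only [enorm_mul] using enorm_integral_le_lintegral_enorm fun y => K (x, y) * h y
    have h2 := ENNReal.lintegral_mul_le_Lp_mul_Lq ν Real.HolderConjugate.two_two
      (f := fun y => ‖K (x, y)‖ₑ) (g := fun y => ‖h y‖ₑ)
      (hKm.comp_measurable measurable_prodMk_left).measurable.enorm.aemeasurable hh.enorm
    refine (ENNReal.rpow_le_rpow (h1.trans h2) (by norm_num)).trans (le_of_eq ?_)
    rw [ENNReal.mul_rpow_of_nonneg _ _ (by norm_num), ← ENNReal.rpow_mul, ← ENNReal.rpow_mul]
    norm_num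
  have hsq : eLpNorm (fun x => ∫ y, K (x, y) * h y ∂ν) 2 μ ^ (2 : ℝ) ≤
      (eLpNorm K 2 (μ.prod ν) * eLpNorm h 2 ν) ^ (2 : ℝ) := by
    rw [ENNReal.mul_rpow_of_nonneg _ _ (by norm_num), ← lintegral_sq_enorm,
      ← lintegral_sq_enorm, ← lintegral_sq_enorm,
      lintegral_prod (fun z => ‖K z‖ₑ ^ (2 : ℝ)) (by have := hKm.measurable; fun_prop)]
    refine (lintegral_mono hpt).trans (le_of_eq ?_)
    exact lintegral_mul_const _ (Measurable.lintegral_prod_right'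
      (f := fun z => ‖K z‖ₑ ^ (2 : ℝ)) (by have := hKm.measurable; fun_prop))
  exact (ENNReal.rpow_le_rpow_iff (by norm_num)).1 hsq

lemma kernel_memLp {K : α × β → ℝ} (hKm : StronglyMeasurable K)
    (hK : MemLp K 2 (μ.prod ν)) (h : Lp ℝ 2 ν) :
    MemLp (fun x => ∫ y, K (x, y) * h y ∂ν) 2 μ := by
  refine ⟨?_, (kernel_eLpNorm_le hKm (Lp.aestronglyMeasurable h)).trans_lt
    (ENNReal.mul_lt_top hK.2 (Lp.memLp h).2)⟩
  exact (StronglyMeasurable.integral_prod_right' (f := fun z : α × β => K z * h z.2)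
    (hKm.mul ((Lp.stronglyMeasurable h).comp_measurable measurable_snd))).aestronglyMeasurable

/-- The operator `h ↦ (x ↦ ∫ K(x, y) h(y) dν(y))` from `L²(ν)` to `L²(μ)` with a kernel
`K ∈ L²(μ ⊗ ν)`. -/
def kernelOperator (K : α × β → ℝ) (hKm : StronglyMeasurable K) (hK : MemLp K 2 (μ.prod ν)) :
    Lp ℝ 2 ν →L[ℝ] Lp ℝ 2 μ :=
  LinearMap.mkContinuous
    { toFun := fun h => (kernel_memLp hKm hK h).toLp (fun x => ∫ y, K (x, y) * h y ∂ν)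
      map_add' := by
        intro f g
        rw [← MemLp.toLp_add]
        refine MemLp.toLp_congr _ _ ?_
        filter_upwards [kernel_section_memLp hKm hK] with x hx
        have hf : Integrable (fun y => K (x, y) * f y) ν := hx.integrable_mul (Lp.memLp f)
        have hg : Integrable (fun y => K (x, y) * g y) ν := hx.integrable_mul (Lp.memLp g)
        rw [Pi.add_apply, ← integral_add hf hg]
        refine integral_congr_ae ?_
        filter_upwards [Lp.coeFn_add f g] with y hy
        rw [hy, Pi.add_apply, mul_add]
      map_smul' := by
        intro c f
        rw [RingHom.id_apply, ← MemLp.toLp_const_smul]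
        refine MemLp.toLp_congr _ _ (Filter.Eventually.of_forall fun x => ?_)
        rw [Pi.smul_apply, smul_eq_mul, ← integral_const_mul]
        refine integral_congr_ae ?_
        filter_upwards [Lp.coeFn_smul c f] with y hy
        rw [hy, Pi.smul_apply, smul_eq_mul]
        ring }
    (eLpNorm K 2 (μ.prod ν)).toReal
    (by
      intro h
      change ‖(kernel_memLp hKm hK h).toLp _‖ ≤ _
      rw [Lp.norm_toLp, Lp.norm_def, ← ENNReal.toReal_mul]
      exact ENNReal.toReal_mono
        (ENNReal.mul_ne_top hK.eLpNorm_ne_top (Lp.memLp h).eLpNorm_ne_top)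
        (kernel_eLpNorm_le hKm (Lp.aestronglyMeasurable h)))

lemma kernelOperator_ae_eq (K : α × β → ℝ) (hKm : StronglyMeasurable K)
    (hK : MemLp K 2 (μ.prod ν)) (h : Lp ℝ 2 ν) :
    kernelOperator K hKm hK h =ᵐ[μ] fun x => ∫ y, K (x, y) * h y ∂ν :=
  MemLp.coeFn_toLp (kernel_memLp hKm hK h)

end KernelOperator

/-! ### Singular values -/

/-- `lam` is the sequence of singular values of `T`: the square roots of the eigenvalues of
`T† T`, in nonincreasing order and counted with multiplicity, continued by zeros if there are only
finitely many positive ones. -/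
structure IsSingularValueSeq {H H' : Type*}
    [NormedAddCommGroup H] [InnerProductSpace ℝ H] [CompleteSpace H]
    [NormedAddCommGroup H'] [InnerProductSpace ℝ H'] [CompleteSpace H']
    (T : H →L[ℝ] H') (lam : ℕ → ℝ) : Prop where
  antitone : Antitone lam
  nonneg : ∀ k, 0 ≤ lam k
  multiplicity : ∀ s : ℝ, 0 < s →
    {k | lam k = s}.encard = Cardinal.toENat (Module.rank ℝ (Module.End.eigenspace
      ((ContinuousLinearMap.adjoint T ∘L T : H →L[ℝ] H) : H →ₗ[ℝ] H) (s ^ 2)))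

/-! ### The broken sample problem -/

section Model

variable {𝓧 𝓨 : Type*} [MeasurableSpace 𝓧] [MeasurableSpace 𝓨]

/-- The single-pair likelihood ratio `L = dP_{XY} / d(P_X ⊗ P_Y)`; `P.fst` and `P.snd` are the
marginals of the joint law `P`. -/
def likelihoodRatio (P : Measure (𝓧 × 𝓨)) (z : 𝓧 × 𝓨) : ℝ :=
  (P.rnDeriv (P.fst.prod P.snd) z).toReal

lemma stronglyMeasurable_likelihoodRatio (P : Measure (𝓧 × 𝓨)) :
    StronglyMeasurable (likelihoodRatio P) :=
  (Measure.measurable_rnDeriv _ _).ennreal_toReal.stronglyMeasurable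

/-- The likelihood ratio operator `(𝓛 h)(x) = E_{Y ∼ P_Y}[L(x, Y) h(Y)]` from `L²(P_Y)` to
`L²(P_X)`, for a square-integrable likelihood ratio. -/
def likelihoodRatioOperator (P : Measure (𝓧 × 𝓨)) [IsProbabilityMeasure P]
    (hL : MemLp (likelihoodRatio P) 2 (P.fst.prod P.snd)) :
    Lp ℝ 2 P.snd →L[ℝ] Lp ℝ 2 P.fst :=
  kernelOperator (likelihoodRatio P) (stronglyMeasurable_likelihoodRatio P) hL

/-- The law of the data `(X_1, …, X_n), (Y_1, …, Y_m)` under the null hypothesis. -/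
def nullLaw (P : Measure (𝓧 × 𝓨)) (n m : ℕ) : Measure ((Fin n → 𝓧) × (Fin m → 𝓨)) :=
  (Measure.pi fun _ : Fin n => P.fst).prod (Measure.pi fun _ : Fin m => P.snd)

open Classical in
/-- Arrange `m` pairs `z i` and the leftover values `w j`, `j ∉ π([m])`, into the data set
`(X, Y)` with `(X (π i), Y i) = z i` and `X j = w j` for `j ∉ π([m])`. -/
def assemble {n m : ℕ} (π : Fin m ↪ Fin n)
    (d : (Fin m → 𝓧 × 𝓨) × ({j : Fin n // j ∉ Set.range π} → 𝓧)) :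
    (Fin n → 𝓧) × (Fin m → 𝓨) :=
  (fun j => if h : j ∈ Set.range π then (d.1 h.choose).1 else d.2 ⟨j, h⟩, fun i => (d.1 i).2)

/-- The law of the data under the alternative, given the latent injection `π`: the pairs
`(X (π i), Y i)` are i.i.d. from `P`, and the other `X j` are i.i.d. from `P_X`, independent of
the pairs. -/
def altLawGiven (P : Measure (𝓧 × 𝓨)) {n m : ℕ} (π : Fin m ↪ Fin n) :
    Measure ((Fin n → 𝓧) × (Fin m → 𝓨)) :=
  ((Measure.pi fun _ : Fin m => P).prod
    (Measure.pi fun _ : {j : Fin n // j ∉ Set.range π} => P.fst)).map (assemble π)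

/-- The law of the data under the alternative: the mixture of `altLawGiven P π` over a uniformly
random injection `π`. -/
def altLaw (P : Measure (𝓧 × 𝓨)) (n m : ℕ) : Measure ((Fin n → 𝓧) × (Fin m → 𝓨)) :=
  (Fintype.card (Fin m ↪ Fin n) : ℝ≥0∞)⁻¹ • ∑ π : Fin m ↪ Fin n, altLawGiven P π

/-- The likelihood ratio `𝐋 = dP_1 / dP_0` of the whole data set. -/
def fullLikelihoodRatio (P : Measure (𝓧 × 𝓨)) (n m : ℕ) (d : (Fin n → 𝓧) × (Fin m → 𝓨)) : ℝ :=
  ((altLaw P n m).rnDeriv (nullLaw P n m) d).toReal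

lemma measurable_assemble {n m : ℕ} (π : Fin m ↪ Fin n) :
    Measurable (assemble (𝓧 := 𝓧) (𝓨 := 𝓨) π) := by
  unfold assemble
  refine Measurable.prodMk (measurable_pi_lambda _ fun j => ?_) (by fun_prop)
  by_cases h : j ∈ Set.range π
  · simp only [h, dite_true]; fun_prop
  · simp only [h, dite_false]; fun_prop

end Model

/-! ### Weights and coefficients -/

/-- `t_ℓ = C(n - ℓ - 1, m - ℓ) / C(n, m)`. For `ℓ ≤ m ≤ n` the natural subtraction truncates only
if `ℓ = m = n`, where `C(-1, 0) = 1 = C(0, 0)`. -/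
def weight (n m l : ℕ) : ℝ :=
  ((n - l - 1).choose (m - l) : ℝ) / (n.choose m : ℝ)

/-- The formal power series `1 / (1 - λ_k² z)`. -/
def factor (lam : ℕ → ℝ) (k : ℕ) : PowerSeries ℝ :=
  (1 - PowerSeries.C (lam k ^ 2) * PowerSeries.X)⁻¹

/-- `a_ℓ`, the `ℓ`-th coefficient of `∏_{k ≥ 0} 1 / (1 - λ_k² z)`; the infinite product is the
limit of the finite products with respect to convergence of every coefficient in `ℝ`. -/
def productCoeff (lam : ℕ → ℝ) (l : ℕ) : ℝ :=
  PowerSeries.coeff l (∏' k, factor lam k)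

end BrokenSample

end

set_option linter.unusedSectionVars false

noncomputable section

namespace BrokenSample

/-! ### Pure tensors in L² of a product measure -/

section Tensor

variable {α β : Type*} [MeasurableSpace α] [MeasurableSpace β]
  {μ : Measure α} {ν : Measure β} [SFinite μ] [SFinite ν]

open scoped RealInnerProductSpace

/-! Write the singular value expansion `L = ∑ λ_k u_k ⊗ v_k` in L². Because `L` is a likelihood
ratio with respect to its own marginals, the operator and its adjoint exchange the constant
functions; so the expansion can be chosen with an index `k₀` where `λ = 1` and `u`, `v` are
constantly one.

The full likelihood ratio is the average over `π` of `∏ L(x_{π i}, y_i)`. For a finite truncation of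
`L` this product is a sum over labellings `κ` of `[m]`. Since `u_{k₀} = 1`, the unpaired `x_j` may
carry the label `k₀`, so each term is a product of orthonormal functions over all `n + m`
coordinates. In the correlation of the terms of `π` and `π'`, orthonormality in `y` forces the
labellings of `[m]` to agree, and orthonormality in `x` forces their extensions to `[n]` to agree.
The second moment is therefore the sum over `κ` of `∏ λ_{κ i}²` times the probability that two
independent uniform injections place the labels of `κ` identically
(`integral_prod_pairing_finiteRank`).

By transitivity of the symmetric group this probability is the order of the stabilizer of a
labelling divided by `n!`, a product of factorials (`sum_extendLabel_eq`). Grouping by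
multiplicities `d`, the monomial `∏ λ_k^{2 d_k}` gets the coefficient `C(n-m+d_{k₀}, d_{k₀}) / C(n,
m)`. The hockey-stick identity splits it into the weights `t_ℓ` with `m - ℓ ≤ d_{k₀}`; as `λ_{k₀} =
1`, the corresponding monomials sum to the complete homogeneous function of degree `ℓ` in the `λ_k²`
(`sum_prod_mul_factorial_valueCount`).

The general case is a limit of truncations: the averaged product depends continuously in L² on the
kernel (`continuous_averagedKernel`), and the coefficients of the finite products converge
(`multipliable_factor`). -/

lemma memLp_two_mul_prod {f : α → ℝ} {g : β → ℝ} (hf : MemLp f 2 μ) (hg : MemLp g 2 ν) :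
    MemLp (fun z : α × β => f z.1 * g z.2) 2 (μ.prod ν) := by
  refine (memLp_two_iff_integrable_sq (hf.1.comp_fst.mul hg.1.comp_snd)).2 ?_
  simp only [Pi.mul_apply, mul_pow]
  exact hf.integrable_sq.mul_prod hg.integrable_sq

/-- The function `(x, y) ↦ f x * g y` as an element of `L²(μ ⊗ ν)`. -/
def tensor (f : Lp ℝ 2 μ) (g : Lp ℝ 2 ν) : Lp ℝ 2 (μ.prod ν) :=
  (memLp_two_mul_prod (Lp.memLp f) (Lp.memLp g)).toLp _

lemma tensor_ae_eq (f : Lp ℝ 2 μ) (g : Lp ℝ 2 ν) :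
    tensor f g =ᵐ[μ.prod ν] fun z => f z.1 * g z.2 :=
  MemLp.coeFn_toLp _

lemma inner_eq_integral_mul {γ : Type*} [MeasurableSpace γ] {ρ : Measure γ} (f g : Lp ℝ 2 ρ) :
    ⟪f, g⟫ = ∫ z, f z * g z ∂ρ := by
  rw [L2.inner_def]
  simp [mul_comm]

lemma inner_tensor (f f' : Lp ℝ 2 μ) (g g' : Lp ℝ 2 ν) :
    ⟪tensor f g, tensor f' g'⟫ = ⟪f, f'⟫ * ⟪g, g'⟫ := by
  rw [inner_eq_integral_mul, inner_eq_integral_mul, inner_eq_integral_mul,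
    ← integral_prod_mul (fun x => f x * f' x) (fun y => g y * g' y)]
  refine integral_congr_ae ?_
  filter_upwards [tensor_ae_eq f g, tensor_ae_eq f' g'] with z h1 h2
  rw [h1, h2]
  ring

/-- Fubini. Through this identity a kernel can be studied by the matrix coefficients of its
operator. -/
lemma inner_kernel_tensor (K : α × β → ℝ) (hKm : StronglyMeasurable K)
    (hK : MemLp K 2 (μ.prod ν)) (f : Lp ℝ 2 μ) (g : Lp ℝ 2 ν) :
    ⟪hK.toLp K, tensor f g⟫ = ⟪f, kernelOperator K hKm hK g⟫ := by
  rw [inner_eq_integral_mul, inner_eq_integral_mul]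
  have h1 : ∫ z, hK.toLp K z * tensor f g z ∂(μ.prod ν)
      = ∫ z, K z * (f z.1 * g z.2) ∂(μ.prod ν) := by
    refine integral_congr_ae ?_
    filter_upwards [tensor_ae_eq f g, hK.coeFn_toLp] with z h1 h2
    rw [h1, h2]
  have h2 : Integrable (fun z => K z * (f z.1 * g z.2)) (μ.prod ν) :=
    hK.integrable_mul (memLp_two_mul_prod (Lp.memLp f) (Lp.memLp g))
  rw [h1, integral_prod _ h2]
  refine integral_congr_ae ?_
  filter_upwards [kernelOperator_ae_eq K hKm hK g] with x hx
  rw [hx, ← integral_const_mul]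
  congr 1 with y
  ring

lemma norm_tensor (f : Lp ℝ 2 μ) (g : Lp ℝ 2 ν) : ‖tensor f g‖ = ‖f‖ * ‖g‖ := by
  rw [← sq_eq_sq₀ (norm_nonneg _) (by positivity), mul_pow, ← real_inner_self_eq_norm_sq,
    ← real_inner_self_eq_norm_sq, ← real_inner_self_eq_norm_sq, inner_tensor]

/-- An integrable function on a product whose integral over every measurable rectangle is zero
vanishes almost everywhere. -/
lemma ae_eq_zero_of_setIntegral_prod_eq_zero {K : α × β → ℝ} (hK : Integrable K (μ.prod ν))
    (h : ∀ s t, MeasurableSet s → MeasurableSet t → ∫ z in s ×ˢ t, K z ∂(μ.prod ν) = 0) :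
    K =ᵐ[μ.prod ν] 0 := by
  refine hK.ae_eq_zero_of_forall_setIntegral_eq_zero fun s hs _ => ?_
  -- The integral over the whole space serves the complement case of the π-λ induction.
  have huniv : ∫ z, K z ∂(μ.prod ν) = 0 := by
    simpa using h Set.univ Set.univ .univ .univ
  clear * - hs hK h huniv
  induction s, hs using MeasurableSpace.induction_on_inter generateFrom_prod.symm
    isPiSystem_prod with
  | empty => simp
  | basic u hu =>
    obtain ⟨s, hs, t, ht, rfl⟩ := hu
    exact h s t hs ht
  | compl u hu ih =>
    have := integral_add_compl hu hK
    rw [huniv, ih] at this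
    simpa using this
  | iUnion f hd hm ih =>
    rw [integral_iUnion hm hd hK.integrableOn]
    simp [ih]

/-- Pure tensors are total: for finite measures they include the indicators of all measurable
rectangles. -/
lemma eq_zero_of_inner_tensor_eq_zero [IsFiniteMeasure μ] [IsFiniteMeasure ν]
    {K : Lp ℝ 2 (μ.prod ν)} (h : ∀ f : Lp ℝ 2 μ, ∀ g : Lp ℝ 2 ν, ⟪K, tensor f g⟫ = 0) :
    K = 0 := by
  have hinteg : Integrable K (μ.prod ν) := (Lp.memLp K).integrable (by norm_num)
  have hz := ae_eq_zero_of_setIntegral_prod_eq_zero hinteg fun s t hs ht => by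
    have hst := h (indicatorConstLp 2 hs (measure_ne_top μ s) (1 : ℝ))
      (indicatorConstLp 2 ht (measure_ne_top ν t) (1 : ℝ))
    rw [inner_eq_integral_mul] at hst
    rw [← hst, ← integral_indicator (hs.prod ht)]
    refine integral_congr_ae ?_
    have hf := (Measure.quasiMeasurePreserving_fst (μ := μ) (ν := ν)).ae
      (indicatorConstLp_coeFn (p := 2) (hs := hs) (hμs := measure_ne_top μ s) (c := (1 : ℝ)))
    have hg := (Measure.quasiMeasurePreserving_snd (μ := μ) (ν := ν)).ae
      (indicatorConstLp_coeFn (p := 2) (hs := ht) (hμs := measure_ne_top ν t) (c := (1 : ℝ)))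
    filter_upwards [tensor_ae_eq (indicatorConstLp 2 hs (measure_ne_top μ s) (1 : ℝ))
      (indicatorConstLp 2 ht (measure_ne_top ν t) (1 : ℝ)), hf, hg] with z h1 h2 h3
    rw [h1, h2, h3]
    by_cases hzs : z.1 ∈ s <;> by_cases hzt : z.2 ∈ t <;> simp [Set.indicator, hzs, hzt]
  exact (Lp.eq_zero_iff_ae_eq_zero).2 hz

end Tensor

/-! ### Compactness of integral operators -/

section HilbertSchmidt

open scoped RealInnerProductSpace

section Abstract

variable {H W : Type*} [NormedAddCommGroup H] [InnerProductSpace ℝ H]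
  [NormedAddCommGroup W] [InnerProductSpace ℝ W] [CompleteSpace W]

/-- A Hilbert–Schmidt operator is compact. -/
lemma isCompactOperator_of_summable_norm_sq {ι : Type*} (b : HilbertBasis ι ℝ H) (T : H →L[ℝ] W)
    (hT : Summable fun i => ‖T (b i)‖ ^ 2) : IsCompactOperator T := by
  classical
  -- `A F` is `T` composed with the projection onto the span of the `b i`, `i ∈ F`. It has finite
  -- rank, and by Cauchy–Schwarz and Bessel its operator-norm distance to `T` is at most the square
  -- root of the tail of `∑ ‖T (b i)‖²`.
  let A : Finset ι → H →L[ℝ] W := fun F => ∑ i ∈ F, (innerSL ℝ (b i)).smulRight (T (b i))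
  have hA : ∀ F, IsCompactOperator (A F) := by
    intro F
    change A F ∈ compactOperator (RingHom.id ℝ) H W
    refine Submodule.sum_mem _ fun i _ => ?_
    have h1 : IsCompactOperator (innerSL ℝ (b i)) :=
      isCompactOperator_of_locallyCompactSpace_dom (innerSL ℝ (b i))
    exact h1.clm_comp (ContinuousLinearMap.toSpanSingleton ℝ (T (b i)))
  refine isCompactOperator_of_tendsto (l := Filter.atTop) (F := A) ?_
    (Filter.Eventually.of_forall hA)
  rw [tendsto_iff_norm_sub_tendsto_zero]
  have htail : Filter.Tendsto (fun F : Finset ι => √(∑' i : {i // i ∉ F}, ‖T (b i)‖ ^ 2))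
      Filter.atTop (nhds 0) := by
    have := (Real.continuous_sqrt.tendsto 0).comp
      (tendsto_tsum_compl_atTop_zero (fun i => ‖T (b i)‖ ^ 2))
    simpa [Function.comp_def] using this
  refine squeeze_zero (fun _ => norm_nonneg _) (fun F => ?_) htail
  refine ContinuousLinearMap.opNorm_le_bound _ (Real.sqrt_nonneg _) fun x => ?_
  have hs : HasSum (fun i => ⟪b i, x⟫ • T (b i)) (T x) := by
    have := (b.hasSum_repr x).mapL T
    simpa [HilbertBasis.repr_apply_apply] using this
  have hc : HasSum (fun i : {i // i ∉ F} => ⟪b i, x⟫ • T (b i)) (T x - A F x) := by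
    have := (F.hasSum_compl_iff (f := fun i => ⟪b i, x⟫ • T (b i)) (a := T x - A F x)).2
    refine this ?_
    simpa [A] using hs
  have hT' : Summable fun i : {i // i ∉ F} => ‖T (b i)‖ ^ 2 := hT.subtype _
  have hx' : Summable fun i => ⟪b i, x⟫ ^ 2 := by
    simpa [sq_abs] using b.orthonormal.inner_products_summable (x := x)
  rw [← norm_neg, _root_.sub_apply, neg_sub]
  refine le_of_tendsto hc.norm (Filter.Eventually.of_forall fun G => ?_)
  calc ‖∑ i ∈ G, ⟪b i, x⟫ • T (b i)‖
      ≤ ∑ i ∈ G, |⟪b i, x⟫| * ‖T (b i)‖ := by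
        refine (norm_sum_le _ _).trans (le_of_eq (Finset.sum_congr rfl fun i _ => ?_))
        rw [norm_smul, Real.norm_eq_abs]
    _ ≤ √(∑ i ∈ G, |⟪b i, x⟫| ^ 2) * √(∑ i ∈ G, ‖T (b i)‖ ^ 2) :=
        Real.sum_mul_le_sqrt_mul_sqrt _ _ _
    _ ≤ ‖x‖ * √(∑' i : {i // i ∉ F}, ‖T (b i)‖ ^ 2) := by
        gcongr
        · refine Real.sqrt_le_iff.2 ⟨norm_nonneg _, ?_⟩
          have h := b.orthonormal.sum_inner_products_le
            (s := G.map (Function.Embedding.subtype _)) x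
          simpa using h
        · exact hT'.sum_le_tsum _ fun _ _ => by positivity
    _ = _ := mul_comm _ _

end Abstract

variable {α β : Type*} [MeasurableSpace α] [MeasurableSpace β]
  {μ : Measure α} {ν : Measure β} [SFinite μ] [SFinite ν]
  {K : α × β → ℝ} (hKm : StronglyMeasurable K) (hK : MemLp K 2 (μ.prod ν))

/-- Bessel's inequality for `K` against the orthonormal tensors of `T v_i / ‖T v_i‖` with `v_i`: the
coefficient of `K` there is `‖T v_i‖`. Indices with `T v_i = 0` are dropped, since they cannot be
normalized. -/
lemma sum_norm_sq_kernelOperator_le {ι : Type*} {v : ι → Lp ℝ 2 ν} (hv : Orthonormal ℝ v)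
    (F : Finset ι) :
    ∑ i ∈ F, ‖kernelOperator K hKm hK (v i)‖ ^ 2 ≤ ‖hK.toLp K‖ ^ 2 := by
  classical
  set T := kernelOperator K hKm hK
  let w : {i // T (v i) ≠ 0} → Lp ℝ 2 (μ.prod ν) :=
    fun i => tensor ((‖T (v i)‖)⁻¹ • T (v i)) (v i)
  have hw : Orthonormal ℝ w := by
    constructor
    · intro i
      simp [w, norm_tensor, norm_smul, hv.1, i.2]
    · intro i j hij
      have : ⟪v i, v j⟫ = 0 := hv.2 fun h => hij (Subtype.ext h)
      simp [w, inner_tensor, this]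
  have hb := hw.sum_inner_products_le (hK.toLp K) (s := F.subtype fun i => T (v i) ≠ 0)
  refine le_trans (le_of_eq ?_) hb
  have hval : ∀ i : {i // T (v i) ≠ 0}, ‖⟪w i, hK.toLp K⟫‖ ^ 2 = ‖T (v i)‖ ^ 2 := by
    intro i
    rw [real_inner_comm, inner_kernel_tensor K hKm hK, real_inner_smul_left,
      real_inner_self_eq_norm_sq, Real.norm_eq_abs, sq_abs]
    have : ‖T (v i)‖ ≠ 0 := by simpa using i.2
    congr 1
    change (‖T (v i)‖)⁻¹ * ‖T (v i)‖ ^ 2 = _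
    field_simp
  rw [Finset.sum_congr rfl fun i _ => hval i,
    Finset.sum_subtype_eq_sum_filter (f := fun i => ‖T (v i)‖ ^ 2), Finset.sum_filter]
  refine Finset.sum_congr rfl fun i _ => ?_
  split_ifs with h
  · rfl
  · simp [not_not.1 h]

lemma summable_norm_sq_kernelOperator {ι : Type*} {v : ι → Lp ℝ 2 ν} (hv : Orthonormal ℝ v) :
    Summable fun i => ‖kernelOperator K hKm hK (v i)‖ ^ 2 :=
  summable_of_sum_le (fun _ => by positivity) (sum_norm_sq_kernelOperator_le hKm hK hv)

lemma isCompactOperator_kernelOperator : IsCompactOperator (kernelOperator K hKm hK) := by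
  obtain ⟨w, b, -⟩ := exists_hilbertBasis ℝ (Lp ℝ 2 ν)
  exact isCompactOperator_of_summable_norm_sq b _
    (summable_norm_sq_kernelOperator hKm hK b.orthonormal)

end HilbertSchmidt

/-! ### Nonincreasing rearrangements -/

section Rearrangement

/-- A family of reals with finitely many members above every positive level has a nonincreasing
rearrangement, continued by zeros. -/
lemma exists_antitone_encard_eq {ι : Type*} (f : ι → ℝ)
    (hfin : ∀ ε, 0 < ε → {i | ε ≤ f i}.Finite) :
    ∃ lam : ℕ → ℝ, Antitone lam ∧ (∀ k, 0 ≤ lam k) ∧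
      ∀ s, 0 < s → {k | lam k = s}.encard = {i | f i = s}.encard := by
  -- `lam k` is the supremum of the levels reached by more than `k` members. Inserting `0` keeps the
  -- set nonempty and produces the tail of zeros.
  let N : ℝ → ℕ := fun t => {i | t ≤ f i}.ncard
  let S : ℕ → Set ℝ := fun k => insert 0 {t | 0 < t ∧ k < N t}
  let lam : ℕ → ℝ := fun k => sSup (S k)
  have hbdd : ∀ k, BddAbove (S k) := by
    intro k
    obtain ⟨B, hB⟩ := ((hfin 1 one_pos).image f).bddAbove
    refine ⟨max 1 B, ?_⟩
    rintro t (rfl | ⟨_, ht⟩)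
    · simp
    · obtain ⟨i, hi⟩ := Set.nonempty_of_ncard_ne_zero (show {i | t ≤ f i}.ncard ≠ 0 by
        change N t ≠ 0; omega)
      rcases le_total 1 (f i) with h1 | h1
      · exact (le_trans hi (hB ⟨i, h1, rfl⟩)).trans (le_max_right _ _)
      · exact (le_trans hi h1).trans (le_max_left _ _)
  have hkey : ∀ s, 0 < s → ∀ k, s ≤ lam k ↔ k < N s := by
    intro s hs k
    constructor
    · intro h
      by_contra! hk
      -- Only finitely many values lie in `[s/2, s)`, so there is a gap `(s', s)` free of values; no
      -- level above `s'` is reached more often than `s`.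
      obtain ⟨s', hs'0, hs's, hs'⟩ : ∃ s', 0 ≤ s' ∧ s' < s ∧ ∀ i, s' < f i → s ≤ f i := by
        have hF : (insert (s / 2) (f '' {i | s / 2 ≤ f i ∧ f i < s})).Finite :=
          (((hfin (s / 2) (by positivity)).subset fun i hi => hi.1).image f).insert _
        obtain ⟨s', hs'm, hmax⟩ := Set.exists_max_image _ id hF ⟨s / 2, Set.mem_insert _ _⟩
        have h2 : s / 2 ≤ s' := hmax _ (Set.mem_insert _ _)
        refine ⟨s', by linarith, ?_, fun i hi => ?_⟩
        · rcases hs'm with rfl | ⟨i, hi, rfl⟩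
          · linarith
          · exact hi.2
        · by_contra! hlt
          have : f i ≤ s' := hmax _ (Set.mem_insert_of_mem _ ⟨i, ⟨by linarith, hlt⟩, rfl⟩)
          linarith
      have : lam k ≤ s' := by
        refine csSup_le ⟨0, Set.mem_insert _ _⟩ ?_
        rintro t (rfl | ⟨_, ht⟩)
        · exact hs'0
        · by_contra! hlt
          have : N t ≤ N s := Set.ncard_le_ncard (fun i hi => hs' i (hlt.trans_le hi)) (hfin s hs)
          omega
      linarith
    · intro h
      exact le_csSup (hbdd k) (Set.mem_insert_of_mem _ ⟨hs, h⟩)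
  have hkey' : ∀ s, 0 < s → ∀ k, s < lam k ↔ k < {i | s < f i}.ncard := by
    intro s hs k
    have hF : {i | s < f i}.Finite := (hfin s hs).subset fun i (hi : s < f i) => hi.le
    constructor
    · intro h
      exact ((hkey _ (hs.trans h) k).1 le_rfl).trans_le
        (Set.ncard_le_ncard (fun i hi => lt_of_lt_of_le h hi) hF)
    · intro h
      obtain ⟨i, hi, hmin⟩ := Set.exists_min_image _ f hF
        (Set.nonempty_of_ncard_ne_zero (show {i | s < f i}.ncard ≠ 0 by omega))
      have hi' : s < f i := hi
      refine hi'.trans_le ((hkey _ (hs.trans hi') k).2 (h.trans_le ?_))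
      exact Set.ncard_le_ncard hmin (hfin _ (hs.trans hi'))
  have h0 : ∀ k, 0 ≤ lam k := fun k => le_csSup (hbdd k) (Set.mem_insert _ _)
  refine ⟨lam, ?_, h0, ?_⟩
  · intro k l hkl
    refine csSup_le_csSup (hbdd k) ⟨0, Set.mem_insert _ _⟩ (Set.insert_subset_insert ?_)
    exact fun t ht => ⟨ht.1, hkl.trans_lt ht.2⟩
  · intro s hs
    -- By the two counting equivalences, the indices with value `s` form an interval whose length is
    -- the number of members equal to `s`.
    have e1 : {k | lam k = s} = Set.Ico {i | s < f i}.ncard (N s) := by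
      ext k
      rw [Set.mem_ofPred_eq, Set.mem_Ico, ← hkey s hs, ← not_lt, ← hkey' s hs, not_lt, and_comm,
        le_antisymm_iff, and_comm]
    have hF : {i | s < f i}.Finite := (hfin s hs).subset fun i (hi : s < f i) => hi.le
    have e2 : {i | f i = s} = {i | s ≤ f i} \ {i | s < f i} := by
      ext i
      simp only [Set.mem_ofPred_eq, Set.mem_sdiff, not_lt]
      rw [le_antisymm_iff, and_comm]
    have hle : {i | s < f i} ⊆ {i | s ≤ f i} := fun i (hi : s < f i) => hi.le
    rw [e1, e2, ← ((hfin s hs).subset Set.sdiff_subset).cast_ncard_eq,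
      Set.ncard_sdiff hle hF, ← (Set.finite_Ico _ _).cast_ncard_eq]
    congr 1
    rw [← Nat.card_coe_set_eq]
    simp [N]

/-- A nonincreasing nonnegative sequence is determined by the multiplicities of its positive
values. -/
lemma eq_of_antitone_of_encard_eq {a b : ℕ → ℝ} (ha : Antitone a) (hb : Antitone b)
    (ha0 : ∀ k, 0 ≤ a k) (hb0 : ∀ k, 0 ≤ b k)
    (h : ∀ s, 0 < s → {k | a k = s}.encard = {k | b k = s}.encard) : a = b := by
  -- At a first disagreement with `a k < b k`, monotonicity puts every index where `a` equals `b k`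
  -- below `k`, where `b` agrees with `a`. The level set of `b` then has `k` as an extra element,
  -- against equal finite cardinality.
  have key : ∀ {a b : ℕ → ℝ}, Antitone a → (∀ k, 0 ≤ a k) →
      (∀ s, 0 < s → {k | a k = s}.encard = {k | b k = s}.encard) →
      ∀ k, (∀ j < k, a j = b j) → ¬ a k < b k := by
    intro a b ha ha0 h k ih hlt
    have hs : 0 < b k := (ha0 k).trans_lt hlt
    have hsub : {j | a j = b k} ⊆ Set.Iio k := by
      intro j hj
      by_contra hjk
      have h1 := ha (not_lt.1 hjk)
      have h2 : a j = b k := hj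
      linarith
    have hss : {j | a j = b k} ⊂ {j | b j = b k} := by
      refine ⟨fun j hj => ?_, fun hcon => ?_⟩
      · rw [Set.mem_ofPred_eq, ← ih j (hsub hj)]
        exact hj
      · have h3 : a k = b k := hcon (show b k = b k from rfl)
        linarith
    exact (((Set.finite_Iio k).subset hsub).encard_lt_encard hss).ne (h _ hs)
  funext k
  induction k using Nat.strong_induction_on with
  | _ k ih =>
    exact le_antisymm
      (not_lt.1 (key hb hb0 (fun s hs => (h s hs).symm) k fun j hj => (ih j hj).symm))
      (not_lt.1 (key ha ha0 h k ih))

end Rearrangement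

/-! ### Singular value decomposition of compact operators -/

section SingularValues

open scoped RealInnerProductSpace InnerProduct
open Module Module.End

variable {H W : Type*} [NormedAddCommGroup H] [InnerProductSpace ℝ H] [CompleteSpace H]
  [NormedAddCommGroup W] [InnerProductSpace ℝ W] [CompleteSpace W]

/-- The eigenspaces of `T† T`. -/
abbrev gramEigenspace (T : H →L[ℝ] W) (c : ℝ) : Submodule ℝ H :=
  eigenspace ((ContinuousLinearMap.adjoint T ∘L T : H →L[ℝ] H) : H →ₗ[ℝ] H) c

variable {T : H →L[ℝ] W}

lemma isSymmetric_gram (T : H →L[ℝ] W) :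
    (((ContinuousLinearMap.adjoint T ∘L T : H →L[ℝ] H)) : H →ₗ[ℝ] H).IsSymmetric := by
  intro x y
  simp [ContinuousLinearMap.adjoint_inner_left, ContinuousLinearMap.adjoint_inner_right]

lemma inner_map_map_of_mem_gramEigenspace {c : ℝ} (x : H) {y : H} (hy : y ∈ gramEigenspace T c) :
    ⟪T x, T y⟫ = c * ⟪x, y⟫ := by
  rw [mem_eigenspace_iff] at hy
  have hy' : ContinuousLinearMap.adjoint T (T y) = c • y := hy
  rw [← ContinuousLinearMap.adjoint_inner_right, hy', real_inner_smul_right]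

lemma norm_sq_map_of_mem_gramEigenspace {c : ℝ} {y : H} (hy : y ∈ gramEigenspace T c) :
    ‖T y‖ ^ 2 = c * ‖y‖ ^ 2 := by
  rw [← real_inner_self_eq_norm_sq, inner_map_map_of_mem_gramEigenspace y hy,
    real_inner_self_eq_norm_sq]

lemma finiteDimensional_gramEigenspace (hT : IsCompactOperator T) {c : ℝ} (hc : c ≠ 0) :
    FiniteDimensional ℝ (gramEigenspace T c) :=
  ContinuousLinearMap.finite_dimensional_eigenspace
    (hT.clm_comp (ContinuousLinearMap.adjoint T)) c hc

lemma gramEigenspace_orthogonal {c d : ℝ} (hcd : c ≠ d) {x y : H} (hx : x ∈ gramEigenspace T c)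
    (hy : y ∈ gramEigenspace T d) : ⟪x, y⟫ = 0 :=
  (isSymmetric_gram T).orthogonalFamily_eigenspaces hcd ⟨x, hx⟩ ⟨y, hy⟩

/-- Existence and uniqueness of the sequence of singular values of a Hilbert–Schmidt operator. -/
lemma existsUnique_isSingularValueSeq (hT : IsCompactOperator T)
    (hHS : ∀ {ι : Type} {v : ι → H}, Orthonormal ℝ v → Summable fun i => ‖T (v i)‖ ^ 2) :
    ∃! lam, IsSingularValueSeq T lam := by
  have hfd : ∀ s : {s : ℝ // 0 < s}, FiniteDimensional ℝ (gramEigenspace T (s.1 ^ 2)) :=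
    fun s => finiteDimensional_gramEigenspace hT (by have := s.2; positivity)
  -- One index for each vector of an orthonormal basis of each eigenspace of `T† T` with eigenvalue
  -- `s² > 0`.
  let ι := Σ s : {s : ℝ // 0 < s}, Fin (finrank ℝ (gramEigenspace T (s.1 ^ 2)))
  let v : ι → H := fun i => (stdOrthonormalBasis ℝ (gramEigenspace T (i.1.1 ^ 2)) i.2 : H)
  have hmem : ∀ i : ι, v i ∈ gramEigenspace T (i.1.1 ^ 2) := fun i => Subtype.property _
  have hv : Orthonormal ℝ v := by
    constructor
    · intro i
      exact (stdOrthonormalBasis ℝ (gramEigenspace T (i.1.1 ^ 2))).orthonormal.1 i.2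
    · rintro ⟨s, i⟩ ⟨t, j⟩ hij
      by_cases hst : s = t
      · subst hst
        exact (stdOrthonormalBasis ℝ (gramEigenspace T (s.1 ^ 2))).orthonormal.2
          fun h => hij (congrArg (Sigma.mk s) h)
      · refine gramEigenspace_orthogonal (c := s.1 ^ 2) (d := t.1 ^ 2) (fun h => hst ?_)
          (hmem ⟨s, i⟩) (hmem ⟨t, j⟩)
        exact Subtype.ext ((sq_eq_sq₀ s.2.le t.2.le).1 h)
  have hnorm : ∀ i : ι, ‖T (v i)‖ ^ 2 = i.1.1 ^ 2 := by
    intro i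
    rw [norm_sq_map_of_mem_gramEigenspace (hmem i), hv.1 i]
    ring
  have hsum := hHS hv
  -- Since `‖T (v i)‖` is the singular value of `v i`, square summability leaves only finitely many
  -- of them above any positive level.
  obtain ⟨lam, h1, h2, h3⟩ := exists_antitone_encard_eq (fun i : ι => i.1.1) fun ε hε => by
    have hev := hsum.tendsto_cofinite_zero.eventually
      (gt_mem_nhds (show (0 : ℝ) < ε ^ 2 by positivity))
    refine Set.Finite.subset hev fun i hi hlt => ?_
    have h1 : ‖T (v i)‖ ^ 2 < ε ^ 2 := hlt
    rw [hnorm] at h1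
    have : ε ≤ i.1.1 := hi
    nlinarith
  have hmult : ∀ s : ℝ, 0 < s →
      {i : ι | i.1.1 = s}.encard = Cardinal.toENat (Module.rank ℝ (gramEigenspace T (s ^ 2))) := by
    intro s hs
    have := hfd ⟨s, hs⟩
    have he : {i : ι | i.1.1 = s} = Set.range (fun j => (⟨⟨s, hs⟩, j⟩ : ι)) := by
      ext ⟨⟨t, ht⟩, j⟩
      constructor
      · rintro rfl
        exact ⟨j, rfl⟩
      · rintro ⟨j', hj'⟩
        exact (congrArg (fun i : ι => i.1.1) hj').symm
    rw [he, ← Module.finrank_eq_rank, ← Set.image_univ,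
      Function.Injective.encard_image (f := fun j => (⟨⟨s, hs⟩, j⟩ : ι))
        (fun a b hab => eq_of_heq (Sigma.mk.inj hab).2)]
    simp
  refine ⟨lam, ⟨h1, h2, fun s hs => (h3 s hs).trans (hmult s hs)⟩, fun lam' h' => ?_⟩
  exact eq_of_antitone_of_encard_eq h'.antitone h1 h'.nonneg h2
    fun s hs => (h'.multiplicity s hs).trans ((h3 s hs).trans (hmult s hs)).symm

lemma encard_eq_finrank_gramEigenspace (hT : IsCompactOperator T) {lam : ℕ → ℝ}
    (hlam : IsSingularValueSeq T lam) {s : ℝ} (hs : 0 < s) :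
    {k | lam k = s}.encard = finrank ℝ (gramEigenspace T (s ^ 2)) := by
  have : FiniteDimensional ℝ (gramEigenspace T (s ^ 2)) :=
    finiteDimensional_gramEigenspace hT (by positivity)
  rw [hlam.multiplicity s hs]
  change Cardinal.toENat (Module.rank ℝ (gramEigenspace T (s ^ 2))) = _
  rw [← Module.finrank_eq_rank, map_natCast]

/-- The indices `k` with `lam k = s` are as many as the dimension of the eigenspace, so they can
index an orthonormal basis of it. When `s = 1` the basis is completed from `e`, placed at `k₀`. -/
lemma exists_orthonormal_gramEigenspace (hT : IsCompactOperator T) {lam : ℕ → ℝ}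
    (hlam : IsSingularValueSeq T lam) {e : H} (he : ‖e‖ = 1) (heT : e ∈ gramEigenspace T 1)
    {k₀ : ℕ} (hk₀ : lam k₀ = 1) (s : {s : ℝ // 0 < s}) :
    ∃ b : {k // lam k = s.1} → H, Orthonormal ℝ b ∧
      (∀ k, b k ∈ gramEigenspace T (s.1 ^ 2)) ∧
      (∀ x, (∀ k, ⟪b k, x⟫ = 0) → ∀ y ∈ gramEigenspace T (s.1 ^ 2), ⟪y, x⟫ = 0) ∧
      ∀ k, k.1 = k₀ → b k = e := by
  classical
  obtain ⟨s, hs⟩ := s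
  have : FiniteDimensional ℝ (gramEigenspace T (s ^ 2)) :=
    finiteDimensional_gramEigenspace hT (by positivity)
  have hcard := encard_eq_finrank_gramEigenspace hT hlam hs
  let : Fintype {k // lam k = s} := (Set.finite_of_encard_eq_coe hcard).fintype
  have hc : finrank ℝ (gramEigenspace T (s ^ 2)) = Fintype.card {k // lam k = s} := by
    rw [← Nat.card_eq_fintype_card]
    exact (ENat.natCast_inj.1
      (((Set.finite_of_encard_eq_coe hcard).cast_ncard_eq).trans hcard)).symm
  let w : {k // lam k = s} → gramEigenspace T (s ^ 2) := fun k =>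
    if h : k.1 = k₀ then ⟨e, by rw [← k.2, h, hk₀, one_pow]; exact heT⟩ else 0
  obtain ⟨b, hb⟩ := Orthonormal.exists_orthonormalBasis_extension_of_card_eq hc
    (v := w) (s := {k | k.1 = k₀}) (by
      constructor
      · rintro ⟨k, hk⟩
        have hk' : k.1 = k₀ := hk
        simp [w, hk', he]
      · rintro ⟨k, hk⟩ ⟨l, hl⟩ hkl
        have hk' : k.1 = k₀ := hk
        have hl' : l.1 = k₀ := hl
        exact absurd (Subtype.ext (Subtype.ext (hk'.trans hl'.symm))) hkl)
  refine ⟨fun k => b k, ?_, fun k => (b k).2, ?_, ?_⟩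
  · exact b.orthonormal.comp_linearIsometry (gramEigenspace T (s ^ 2)).subtypeₗᵢ
  · intro x hx y hy
    have hr := congrArg (fun z : gramEigenspace T (s ^ 2) => ⟪(z : H), x⟫) (b.sum_repr' ⟨y, hy⟩)
    refine Eq.trans hr.symm ?_
    rw [Submodule.coe_sum, sum_inner]
    refine Finset.sum_eq_zero fun k _ => ?_
    rw [Submodule.coe_smul, real_inner_smul_left, hx k, mul_zero]
  · intro k hk
    change ((b k : gramEigenspace T (s ^ 2)) : H) = e
    rw [hb k hk]
    simp [w, hk]

/-- Spectral theorem: `T† T x` is orthogonal to every eigenspace of `T† T`, hence zero, and `‖T x‖²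
= ⟪x, T† T x⟫`. Nonpositive eigenvalues need no hypothesis: negative ones have trivial eigenspaces,
and `T` vanishes on the eigenspace of zero. -/
lemma map_eq_zero_of_inner_gramEigenspace (hT : IsCompactOperator T) {x : H}
    (hx : ∀ c, 0 < c → ∀ y ∈ gramEigenspace T c, ⟪y, x⟫ = 0) : T x = 0 := by
  have horth : ∀ c, ∀ y ∈ gramEigenspace T c, ⟪T y, T x⟫ = 0 := by
    intro c y hy
    rw [real_inner_comm, inner_map_map_of_mem_gramEigenspace x hy]
    rcases lt_trichotomy c 0 with hc | rfl | hc
    · have h1 := norm_sq_map_of_mem_gramEigenspace hy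
      have h2 : ‖y‖ ^ 2 = 0 := by nlinarith [sq_nonneg ‖T y‖, sq_nonneg ‖y‖]
      have h3 : y = 0 := by simpa using h2
      simp [h3]
    · simp
    · rw [real_inner_comm, hx c hc y hy, mul_zero]
  have hcomp : IsCompactOperator (ContinuousLinearMap.adjoint T ∘L T) :=
    hT.clm_comp (ContinuousLinearMap.adjoint T)
  have hbot : (⨆ c, gramEigenspace T c)ᗮ = ⊥ :=
    ContinuousLinearMap.orthogonalComplement_iSup_eigenspaces_eq_bot hcomp (isSymmetric_gram T)
  have hin : ContinuousLinearMap.adjoint T (T x) ∈ (⨆ c, gramEigenspace T c)ᗮ := by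
    rw [← Submodule.iInf_orthogonal, Submodule.mem_iInf]
    intro c
    rw [Submodule.mem_orthogonal]
    intro y hy
    rw [ContinuousLinearMap.adjoint_inner_right]
    exact horth c y hy
  rw [hbot, Submodule.mem_bot] at hin
  have h0 : ‖T x‖ ^ 2 = 0 := by
    rw [← real_inner_self_eq_norm_sq, ← ContinuousLinearMap.adjoint_inner_right, hin,
      inner_zero_right]
  simpa using h0

/-- Right singular vectors of a compact operator, one for each positive member of its sequence of
singular values, with a prescribed singular vector `e` of singular value one among them. -/
lemma exists_singularVectors (hT : IsCompactOperator T) {lam : ℕ → ℝ}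
    (hlam : IsSingularValueSeq T lam) {e : H} (he : ‖e‖ = 1) (heT : e ∈ gramEigenspace T 1) :
    ∃ v : {k // 0 < lam k} → H, Orthonormal ℝ v ∧
      (∀ k : {k // 0 < lam k}, v k ∈ gramEigenspace T (lam k ^ 2)) ∧
      (∃ k₀ : {k // 0 < lam k}, lam k₀ = 1 ∧ v k₀ = e) ∧
      ∀ x, (∀ k, ⟪v k, x⟫ = 0) → T x = 0 := by
  obtain ⟨k₀, hk₀⟩ : ∃ k₀, lam k₀ = 1 := by
    by_contra! hne
    have h1 := encard_eq_finrank_gramEigenspace hT hlam one_pos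
    rw [show {k | lam k = 1} = ∅ from Set.eq_empty_of_forall_notMem hne, Set.encard_empty,
      one_pow] at h1
    have := finiteDimensional_gramEigenspace hT one_ne_zero
    have h0 : finrank ℝ (gramEigenspace T 1) = 0 := by exact_mod_cast h1.symm
    rw [Submodule.finrank_eq_zero] at h0
    rw [h0, Submodule.mem_bot] at heT
    simp [heT] at he
  choose b hbo hbm hbs hbe using exists_orthonormal_gramEigenspace hT hlam he heT hk₀
  let v : {k // 0 < lam k} → H := fun k => b ⟨lam k, k.2⟩ ⟨k, rfl⟩
  -- Stated for arbitrary `s` so that `lam k = s` can be substituted; this handles the dependence of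
  -- `b` on the singular value.
  have hvb : ∀ (s : {s : ℝ // 0 < s}) (k : {k // lam k = s.1}),
      v ⟨k.1, by rw [k.2]; exact s.2⟩ = b s k := by
    rintro ⟨s, hs⟩ ⟨k, hk⟩
    change lam k = s at hk
    subst hk
    rfl
  have hmem : ∀ k : {k // 0 < lam k}, v k ∈ gramEigenspace T (lam k ^ 2) :=
    fun k => hbm ⟨lam k, k.2⟩ ⟨k, rfl⟩
  refine ⟨v, ⟨fun k => (hbo ⟨lam k, k.2⟩).1 ⟨k, rfl⟩, fun k l hkl => ?_⟩, hmem,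
    ⟨⟨k₀, hk₀ ▸ one_pos⟩, hk₀, hbe ⟨lam k₀, hk₀ ▸ one_pos⟩ ⟨k₀, rfl⟩ rfl⟩, ?_⟩
  · by_cases h : lam l = lam k
    · have h1 := hvb ⟨lam k, k.2⟩ ⟨l, h⟩
      change v l = _ at h1
      change ⟪v k, v l⟫ = 0
      rw [h1]
      exact (hbo ⟨lam k, k.2⟩).2 fun h2 => hkl (Subtype.ext (congrArg (fun z => z.1) h2))
    · refine gramEigenspace_orthogonal (fun h' => h ?_) (hmem k) (hmem l)
      exact ((sq_eq_sq₀ k.2.le l.2.le).1 h').symm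
  · intro x hx
    refine map_eq_zero_of_inner_gramEigenspace hT fun c hc y hy => ?_
    have hy' : y ∈ gramEigenspace T (√c ^ 2) := by rwa [Real.sq_sqrt hc.le]
    have hx' : ∀ k, ⟪b ⟨√c, Real.sqrt_pos.2 hc⟩ k, x⟫ = 0 := by
      intro k
      rw [← hvb ⟨√c, Real.sqrt_pos.2 hc⟩ k]
      exact hx _
    exact hbs ⟨√c, Real.sqrt_pos.2 hc⟩ x hx' y hy'

lemma summable_smul_orthonormal {ι : Type*} {v : ι → H} (hv : Orthonormal ℝ v) {c : ι → ℝ}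
    (hc : Summable fun i => c i ^ 2) : Summable fun i => c i • v i := by
  have := (hv.orthogonalFamily.summable_iff_norm_sq_summable c).2 (by simpa using hc)
  simpa using this

/-- The action of a compact operator through its right singular vectors. -/
lemma hasSum_inner_smul_map {ι : Type*} {v : ι → H} (hv : Orthonormal ℝ v)
    (hker : ∀ x, (∀ k, ⟪v k, x⟫ = 0) → T x = 0) (x : H) :
    HasSum (fun k => ⟪v k, x⟫ • T (v k)) (T x) := by
  classical
  have hs : Summable fun k => ⟪v k, x⟫ • v k :=
    summable_smul_orthonormal hv (by simpa using hv.inner_products_summable (x := x))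
  have hsum := hs.hasSum
  set p := ∑' k, ⟪v k, x⟫ • v k
  -- `p` is the projection of `x` onto the closed span of the `v k`, so `x - p` is orthogonal to all
  -- of them.
  have hp : T (x - p) = 0 := by
    refine hker _ fun j => ?_
    have h1 : HasSum (fun k => ⟪v j, ⟪v k, x⟫ • v k⟫) ⟪v j, p⟫ := hsum.mapL (innerSL ℝ (v j))
    have h2 : HasSum (fun k => ⟪v j, ⟪v k, x⟫ • v k⟫) ⟪v j, x⟫ := by
      convert hasSum_single j fun k hk => ?_ using 1
      · simp [real_inner_smul_right, hv.1 j]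
      · rw [real_inner_smul_right, hv.2 hk.symm, mul_zero]
    rw [inner_sub_right, h1.unique h2, sub_self]
  rw [map_sub, sub_eq_zero] at hp
  rw [hp]
  simpa using hsum.mapL T

end SingularValues

/-! ### Singular value expansion of a kernel -/

section KernelExpansion

open scoped RealInnerProductSpace

variable {α β : Type*} [MeasurableSpace α] [MeasurableSpace β]
  {μ : Measure α} {ν : Measure β} [IsFiniteMeasure μ] [IsFiniteMeasure ν]
  {K : α × β → ℝ} {hKm : StronglyMeasurable K} {hK : MemLp K 2 (μ.prod ν)}

/-- The singular value expansion of a square-integrable kernel. -/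
lemma hasSum_kernel {ι : Type*} {u : ι → Lp ℝ 2 μ} {v : ι → Lp ℝ 2 ν} {c : ι → ℝ}
    (hu : Orthonormal ℝ u) (hv : Orthonormal ℝ v)
    (hT : ∀ i, kernelOperator K hKm hK (v i) = c i • u i)
    (hker : ∀ x, (∀ i, ⟪v i, x⟫ = 0) → kernelOperator K hKm hK x = 0) :
    HasSum (fun i => c i • tensor (u i) (v i)) (hK.toLp K) := by
  have hw : Orthonormal ℝ fun i => tensor (u i) (v i) := by
    refine ⟨fun i => by rw [norm_tensor, hu.1, hv.1, one_mul], fun i j hij => ?_⟩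
    change ⟪tensor (u i) (v i), tensor (u j) (v j)⟫ = 0
    rw [inner_tensor, hu.2 hij, zero_mul]
  have hc : Summable fun i => c i ^ 2 := by
    have := summable_norm_sq_kernelOperator hKm hK hv
    simpa [hT, norm_smul, hu.1] using this
  have hs := (summable_smul_orthonormal hw hc).hasSum
  set S := ∑' i, c i • tensor (u i) (v i)
  -- Kernel and series have the same inner product with every pure tensor, and pure tensors are
  -- total.
  have hz : hK.toLp K - S = 0 := by
    refine eq_zero_of_inner_tensor_eq_zero fun f g => ?_
    have h1 : HasSum (fun i => ⟪tensor f g, c i • tensor (u i) (v i)⟫) ⟪tensor f g, S⟫ :=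
      hs.mapL (innerSL ℝ (tensor f g))
    have h2 : HasSum (fun i => ⟪f, ⟪v i, g⟫ • kernelOperator K hKm hK (v i)⟫)
        ⟪f, kernelOperator K hKm hK g⟫ :=
      (hasSum_inner_smul_map hv hker g).mapL (innerSL ℝ f)
    rw [inner_sub_left, inner_kernel_tensor K hKm hK, ← real_inner_comm S, sub_eq_zero]
    refine h2.unique (h1.congr_fun ?_)
    intro i
    rw [hT, real_inner_smul_right, real_inner_smul_right, real_inner_smul_right, inner_tensor,
      real_inner_comm g]
    ring
  rw [sub_eq_zero] at hz
  rw [hz]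
  exact hs

end KernelExpansion

/-! ### Complete homogeneous symmetric functions -/

section CompleteHomogeneous

open Finset

/-- The complete homogeneous symmetric polynomial of degree `l`, evaluated at the family `c`
restricted to the index set `s`. -/
def completeHomogeneous {ι : Type*} [DecidableEq ι] (c : ι → ℝ) (s : Finset ι) (l : ℕ) : ℝ :=
  ∑ d ∈ s.piAntidiag l, ∏ k ∈ s, c k ^ d k

lemma coeff_inv_one_sub_C_mul_X (a : ℝ) (l : ℕ) :
    PowerSeries.coeff l (1 - PowerSeries.C a * PowerSeries.X)⁻¹ = a ^ l := by
  have h : PowerSeries.mk (fun n => a ^ n) = (1 - PowerSeries.C a * PowerSeries.X)⁻¹ := by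
    rw [PowerSeries.eq_inv_iff_mul_eq_one (by simp)]
    ext n
    rw [mul_sub, mul_one, ← mul_assoc, map_sub]
    cases n with
    | zero => simp
    | succ n =>
      rw [PowerSeries.coeff_succ_mul_X, PowerSeries.coeff_mul_C, PowerSeries.coeff_mk,
        PowerSeries.coeff_mk, PowerSeries.coeff_one, if_neg n.succ_ne_zero]
      ring
  rw [← h, PowerSeries.coeff_mk]

lemma coeff_prod_factor (lam : ℕ → ℝ) (s : Finset ℕ) (l : ℕ) :
    PowerSeries.coeff l (∏ k ∈ s, factor lam k) = completeHomogeneous (fun k => lam k ^ 2) s l := by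
  rw [PowerSeries.coeff_prod, completeHomogeneous]
  refine Finset.sum_bij (fun d _ => ⇑d) ?_ ?_ ?_ ?_
  · intro d hd
    rw [mem_finsuppAntidiag] at hd
    rw [mem_piAntidiag]
    exact ⟨hd.1, fun i hi => hd.2 (Finsupp.mem_support_iff.2 hi)⟩
  · intro d _ d' _ h
    exact DFunLike.coe_injective h
  · intro d hd
    rw [mem_piAntidiag] at hd
    refine ⟨Finsupp.onFinset s d hd.2, ?_, rfl⟩
    rw [mem_finsuppAntidiag]
    exact ⟨hd.1, Finsupp.support_onFinset_subset⟩
  · intro d _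
    exact Finset.prod_congr rfl fun k _ => coeff_inv_one_sub_C_mul_X _ _

variable {ι : Type*} [DecidableEq ι] {c : ι → ℝ}

lemma completeHomogeneous_mono (hc : ∀ k, 0 ≤ c k) (l : ℕ) :
    Monotone fun s => completeHomogeneous c s l := by
  intro s t hst
  calc completeHomogeneous c s l = ∑ d ∈ s.piAntidiag l, ∏ k ∈ t, c k ^ d k := by
        refine Finset.sum_congr rfl fun d hd => Finset.prod_subset hst fun k _ hk => ?_
        have : d k = 0 := by
          by_contra h
          exact hk ((mem_piAntidiag.1 hd).2 k h)
        rw [this, pow_zero]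
    _ ≤ completeHomogeneous c t l := by
        refine Finset.sum_le_sum_of_subset_of_nonneg (fun d hd => ?_) fun d _ _ =>
          Finset.prod_nonneg fun k _ => pow_nonneg (hc k) _
        rw [mem_piAntidiag] at hd ⊢
        refine ⟨?_, fun i hi => hst (hd.2 i hi)⟩
        rw [← hd.1]
        refine (Finset.sum_subset hst fun k _ hk => ?_).symm
        by_contra h
        exact hk (hd.2 k h)

/-- The multinomial expansion of the power has the same monomials with coefficients at least one. -/
lemma completeHomogeneous_le (hc : ∀ k, 0 ≤ c k) (s : Finset ι) (l : ℕ) :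
    completeHomogeneous c s l ≤ (∑ k ∈ s, c k) ^ l := by
  rw [Finset.sum_pow_eq_sum_piAntidiag]
  refine Finset.sum_le_sum fun d _ => ?_
  have h0 : 0 ≤ ∏ k ∈ s, c k ^ d k := Finset.prod_nonneg fun k _ => pow_nonneg (hc k) _
  have h1 : (1 : ℝ) ≤ Nat.multinomial s d := by exact_mod_cast Nat.multinomial_pos s d
  exact le_mul_of_one_le_left h0 h1

/-- Each coefficient of the finite products increases with the index set and is bounded by `(∑
λ_k²)^l`, so it converges to its supremum. -/
lemma multipliable_factor {lam : ℕ → ℝ} (h : Summable fun k => lam k ^ 2) :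
    Multipliable (factor lam) := by
  refine ⟨PowerSeries.mk fun l => ⨆ s, completeHomogeneous (fun k => lam k ^ 2) s l, ?_⟩
  rw [HasProd, SummationFilter.unconditional_filter,
    PowerSeries.WithPiTopology.tendsto_iff_coeff_tendsto]
  intro l
  simp only [coeff_prod_factor, PowerSeries.coeff_mk]
  refine tendsto_atTop_ciSup (completeHomogeneous_mono (fun k => sq_nonneg _) l)
    ⟨(∑' k, lam k ^ 2) ^ l, ?_⟩
  rintro _ ⟨s, rfl⟩
  refine (completeHomogeneous_le (fun k => sq_nonneg _) s l).trans ?_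
  gcongr
  exact h.sum_le_tsum s fun _ _ => sq_nonneg _

lemma completeHomogeneous_map {κ : Type*} [DecidableEq κ] (e : κ ↪ ι) (c : ι → ℝ) (s : Finset κ)
    (l : ℕ) : completeHomogeneous c (s.map e) l = completeHomogeneous (c ∘ e) s l := by
  rw [completeHomogeneous, completeHomogeneous]
  refine Finset.sum_bij' (fun d _ => d ∘ e) (fun d _ => Function.extend e d 0) ?_ ?_ ?_ ?_ ?_
  · intro d hd
    rw [mem_piAntidiag, Finset.sum_map] at hd
    rw [mem_piAntidiag]
    refine ⟨hd.1, fun i hi => ?_⟩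
    simpa using hd.2 _ hi
  · intro d hd
    rw [mem_piAntidiag] at hd
    rw [mem_piAntidiag, Finset.sum_map]
    refine ⟨by simpa [e.injective.extend_apply] using hd.1, fun i hi => ?_⟩
    by_cases h : ∃ k, e k = i
    · obtain ⟨k, rfl⟩ := h
      rw [e.injective.extend_apply] at hi
      exact Finset.mem_map_of_mem e (hd.2 k hi)
    · rw [Function.extend_apply' _ _ _ h] at hi
      exact absurd rfl hi
  · intro d hd
    rw [mem_piAntidiag] at hd
    funext i
    by_cases h : ∃ k, e k = i
    · obtain ⟨k, rfl⟩ := h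
      rw [e.injective.extend_apply]
      rfl
    · rw [Function.extend_apply' _ _ _ h]
      by_contra hne
      obtain ⟨k, -, hk⟩ := Finset.mem_map.1 (hd.2 i (Ne.symm hne))
      exact h ⟨k, hk⟩
  · intro d _
    exact Function.extend_comp e.injective d 0
  · intro d _
    rw [Finset.prod_map]
    rfl

/-- The coefficients of the infinite product are limits over finite sets of indices with
`lam k > 0`. -/
lemma tendsto_completeHomogeneous {lam : ℕ → ℝ} (hlam : ∀ k, 0 ≤ lam k)
    (h : Multipliable (factor lam)) (l : ℕ) :
    Filter.Tendsto (fun s : Finset {k // 0 < lam k} =>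
      completeHomogeneous (fun k : {k // 0 < lam k} => lam k ^ 2) s l) Filter.atTop
      (nhds (productCoeff lam l)) := by
  have h1 : HasProd (fun k : {k | 0 < lam k} => factor lam k) (∏' k, factor lam k) := by
    refine (hasProd_subtype_iff_of_mulSupport_subset (f := factor lam) fun k hk => ?_).2 h.hasProd
    by_contra h0
    have h0' : lam k = 0 := le_antisymm (not_lt.1 h0) (hlam k)
    exact hk (by simp [factor, h0'])
  rw [HasProd, SummationFilter.unconditional_filter,
    PowerSeries.WithPiTopology.tendsto_iff_coeff_tendsto] at h1
  refine (h1 l).congr fun s => ?_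
  have h2 := coeff_prod_factor lam (s.map (Function.Embedding.subtype _)) l
  rw [Finset.prod_map, completeHomogeneous_map] at h2
  exact h2

end CompleteHomogeneous

/-! ### Counting -/

section Counting

open Finset

/-- The number of times `κ` takes the value `k`. -/
def valueCount {α ι : Type*} [Fintype α] [DecidableEq ι] (κ : α → ι) (k : ι) : ℕ :=
  #{a | κ a = k}

/-- A sum over all functions of an expression that depends only on the multiplicities of the
values. -/
lemma sum_valueCount {α ι : Type*} [Fintype α] [DecidableEq α] [Fintype ι] [DecidableEq ι]
    (φ : (ι → ℕ) → ℝ) :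
    ∑ κ : α → ι, φ (valueCount κ) =
      ∑ d ∈ (univ : Finset ι).piAntidiag (Fintype.card α), Nat.multinomial univ d * φ d := by
  -- `Φ` sends the monomial with exponent `d` to `φ d`. Applying it to two expansions of `(∑
  -- X_k)^|α|`, over functions and by the multinomial theorem, gives the claim.
  let Φ : MvPolynomial ι ℝ →ₗ[ℝ] ℝ := (MvPolynomial.basisMonomials ι ℝ).constr ℝ fun d => φ d
  have hΦ : ∀ d : ι → ℕ, Φ (∏ k, MvPolynomial.X k ^ d k) = φ d := by
    intro d
    have h1 : (∏ k, MvPolynomial.X k ^ d k : MvPolynomial ι ℝ) =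
        MvPolynomial.basisMonomials ι ℝ (Finsupp.equivFunOnFinite.symm d) := by
      rw [MvPolynomial.coe_basisMonomials]
      beta_reduce
      rw [MvPolynomial.monomial_eq, map_one, one_mul,
        Finsupp.prod_fintype _ _ (fun _ => pow_zero _)]
      rfl
    rw [h1, Module.Basis.constr_basis]
    rfl
  have hprod : ∀ κ : α → ι, (∏ a, MvPolynomial.X (κ a) : MvPolynomial ι ℝ) =
      ∏ k, MvPolynomial.X k ^ valueCount κ k := by
    intro κ
    rw [← Finset.prod_fiberwise univ κ]
    refine Finset.prod_congr rfl fun k _ => ?_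
    rw [Finset.prod_congr rfl (g := fun _ => MvPolynomial.X k)
      fun a ha => by rw [(Finset.mem_filter.1 ha).2], Finset.prod_const]
    rfl
  have h1 : ∏ _a : α, (∑ k : ι, MvPolynomial.X k : MvPolynomial ι ℝ) =
      ∑ κ : α → ι, ∏ a, MvPolynomial.X (κ a) := by
    rw [Finset.prod_univ_sum, Fintype.piFinset_univ]
  rw [Finset.prod_const, Finset.card_univ, Finset.sum_pow_eq_sum_piAntidiag] at h1
  have h2 := congrArg Φ h1
  rw [map_sum, map_sum] at h2
  rw [Finset.sum_congr rfl fun κ _ => by rw [← hΦ (valueCount κ), ← hprod], ← h2]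
  refine Finset.sum_congr rfl fun d _ => ?_
  rw [← nsmul_eq_mul, map_nsmul, hΦ, nsmul_eq_mul]

lemma prod_comp_eq_prod_pow_valueCount {α ι : Type*} [Fintype α] [Fintype ι] [DecidableEq ι]
    (c : ι → ℝ) (κ : α → ι) : ∏ a, c (κ a) = ∏ k, c k ^ valueCount κ k := by
  rw [← Finset.prod_fiberwise univ κ]
  refine Finset.prod_congr rfl fun k _ => ?_
  rw [Finset.prod_congr rfl (g := fun _ => c k)
    fun a ha => by rw [(Finset.mem_filter.1 ha).2], Finset.prod_const]
  rfl

/-! ### Coincidence of labellings under random injections -/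

section Injections

variable {m n : ℕ}

/-- Averages over injections as averages over permutations. -/
lemma sum_perm_smul (g : (Fin m ↪ Fin n) → ℝ) (π : Fin m ↪ Fin n) :
    (Fintype.card (Fin m ↪ Fin n) : ℝ) * ∑ σ : Equiv.Perm (Fin n), g (σ • π) =
      (n.factorial : ℝ) * ∑ π', g π' := by
  have htrans := Equiv.Perm.isMultiplyPretransitive (Fin n) m
  let N : (Fin m ↪ Fin n) → ℕ := fun π' => #{σ : Equiv.Perm (Fin n) | σ • π = π'}
  -- Left translation by some `τ` with `τ • π = π'` is a bijection between the fibres of `σ ↦ σ •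
  -- π`.
  have hN : ∀ π', N π' = N π := by
    intro π'
    obtain ⟨τ, hτ⟩ := htrans.exists_smul_eq π π'
    symm
    refine Finset.card_bij (fun σ _ => τ * σ) ?_ ?_ ?_
    · intro σ hσ
      simp only [Finset.mem_filter, Finset.mem_univ, true_and] at hσ ⊢
      rw [mul_smul, hσ, hτ]
    · intro σ _ σ' _ h
      exact mul_left_cancel h
    · intro σ hσ
      simp only [Finset.mem_filter, Finset.mem_univ, true_and] at hσ
      refine ⟨τ⁻¹ * σ, ?_, by simp⟩
      simp only [Finset.mem_filter, Finset.mem_univ, true_and]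
      rw [mul_smul, hσ, ← hτ, inv_smul_smul]
  have hsum : ∀ g : (Fin m ↪ Fin n) → ℝ,
      ∑ σ : Equiv.Perm (Fin n), g (σ • π) = N π * ∑ π', g π' := by
    intro g
    rw [← Finset.sum_fiberwise univ (fun σ : Equiv.Perm (Fin n) => σ • π), Finset.mul_sum]
    refine Finset.sum_congr rfl fun π' _ => ?_
    rw [Finset.sum_congr rfl (g := fun _ => g π')
      fun a ha => by rw [(Finset.mem_filter.1 ha).2], Finset.sum_const, nsmul_eq_mul, ← hN π']
  have hcard : (n.factorial : ℝ) = N π * Fintype.card (Fin m ↪ Fin n) := by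
    have := hsum fun _ => 1
    simpa [Fintype.card_perm] using this
  rw [hsum, hcard]
  ring

variable {ι : Type*} [DecidableEq ι]

/-- Extend a labelling of `Fin m` along an injection by a constant label. -/
def extendLabel (k₀ : ι) (κ : Fin m → ι) (π : Fin m ↪ Fin n) : Fin n → ι :=
  Function.extend π κ fun _ => k₀

/-- Equivariance: this turns coincidence of the labellings of `π` and `σ • π` into `σ` fixing one
labelling. -/
lemma extendLabel_smul (k₀ : ι) (κ : Fin m → ι) (π : Fin m ↪ Fin n) (σ : Equiv.Perm (Fin n)) :
    extendLabel k₀ κ (σ • π) ∘ σ = extendLabel k₀ κ π := by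
  funext j
  rw [Function.comp_apply, extendLabel, extendLabel]
  by_cases h : ∃ i, π i = j
  · obtain ⟨i, rfl⟩ := h
    rw [π.injective.extend_apply]
    exact (σ • π).injective.extend_apply κ _ i
  · have h' : ¬ ∃ i, (σ • π) i = σ j := fun ⟨i, hi⟩ => h ⟨i, σ.injective hi⟩
    rw [Function.extend_apply' _ _ _ h, Function.extend_apply' _ _ _ h']

lemma valueCount_extendLabel (k₀ : ι) (κ : Fin m → ι) (π : Fin m ↪ Fin n) (k : ι) :
    valueCount (extendLabel k₀ κ π) k = valueCount κ k + if k = k₀ then n - m else 0 := by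
  have hsplit := Finset.card_filter_add_card_filter_not (s := {j | extendLabel k₀ κ π j = k})
    (fun j => j ∈ univ.map π)
  rw [valueCount, ← hsplit]
  congr 1
  · rw [valueCount, ← Finset.card_map π]
    congr 1
    ext j
    simp only [Finset.mem_filter, Finset.mem_univ, true_and, Finset.mem_map]
    constructor
    · rintro ⟨h, i, rfl⟩
      rw [extendLabel, π.injective.extend_apply] at h
      exact ⟨i, h, rfl⟩
    · rintro ⟨i, h, rfl⟩
      rw [extendLabel, π.injective.extend_apply]
      exact ⟨h, i, rfl⟩
  · have hval : ∀ j, j ∉ univ.map π → extendLabel k₀ κ π j = k₀ := by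
      intro j hj
      refine Function.extend_apply' _ _ _ fun ⟨i, hi⟩ => hj ?_
      rw [← hi]
      exact Finset.mem_map_of_mem π (Finset.mem_univ i)
    split_ifs with hk
    · have : ({j | extendLabel k₀ κ π j = k} : Finset (Fin n)).filter (fun j => j ∉ univ.map π) =
          (univ.map π)ᶜ := by
        ext j
        simp only [Finset.mem_filter, Finset.mem_univ, true_and, Finset.mem_compl]
        exact ⟨fun h => h.2, fun h => ⟨by rw [hval j h, hk], h⟩⟩
      rw [this, Finset.card_compl, Finset.card_map]
      simp
    · rw [Finset.card_eq_zero, Finset.filter_eq_empty_iff]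
      intro j hj hj'
      rw [Finset.mem_filter, hval j hj'] at hj
      exact hk hj.2.symm

/-- The probability that two independent uniform injections place labels in the same way. -/
lemma sum_extendLabel_eq [Fintype ι] (k₀ : ι) (κ : Fin m → ι) :
    (n.factorial : ℝ) * ∑ π : Fin m ↪ Fin n, ∑ π' : Fin m ↪ Fin n,
        (if extendLabel k₀ κ π = extendLabel k₀ κ π' then (1 : ℝ) else 0) =
      (Fintype.card (Fin m ↪ Fin n) : ℝ) ^ 2 *
        ∏ k, ((valueCount κ k + if k = k₀ then n - m else 0).factorial : ℝ) := by
  have hinner : ∀ π : Fin m ↪ Fin n, (n.factorial : ℝ) * ∑ π' : Fin m ↪ Fin n,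
      (if extendLabel k₀ κ π = extendLabel k₀ κ π' then (1 : ℝ) else 0) =
      (Fintype.card (Fin m ↪ Fin n) : ℝ) *
        ∏ k, ((valueCount κ k + if k = k₀ then n - m else 0).factorial : ℝ) := by
    intro π
    rw [← sum_perm_smul _ π]
    congr 1
    have hst := DomMulAct.stabilizer_card (extendLabel k₀ κ π)
    rw [Finset.sum_boole]
    -- The favourable permutations form the stabilizer of the labelling, whose order is the product
    -- of the factorials of the label multiplicities.
    have h1 : #{σ : Equiv.Perm (Fin n) | extendLabel k₀ κ π = extendLabel k₀ κ (σ • π)} =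
        Fintype.card {g : Equiv.Perm (Fin n) // extendLabel k₀ κ π ∘ g = extendLabel k₀ κ π} := by
      rw [Fintype.card_subtype]
      congr 1
      ext σ
      simp only [Finset.mem_filter, Finset.mem_univ, true_and]
      have h2 := extendLabel_smul k₀ κ π σ
      constructor
      · intro h
        rw [← h] at h2
        exact h2
      · intro h
        exact σ.surjective.injective_comp_right (h.trans h2.symm)
    rw [h1, hst, Nat.cast_prod]
    refine Finset.prod_congr rfl fun k _ => ?_
    rw [← valueCount_extendLabel k₀ κ π k, valueCount, Fintype.card_subtype]
  rw [Finset.mul_sum, Finset.sum_congr rfl fun π _ => hinner π, Finset.sum_const, nsmul_eq_mul,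
    Finset.card_univ]
  ring

end Injections

/-- The hockey-stick identity. For `p = j = 0` truncated subtraction gives `C(0, 0) = 1`, matching
the convention `C(-1, 0) = 1`. -/
lemma sum_range_choose_sub_one (p r : ℕ) :
    ∑ j ∈ range (r + 1), (p + j - 1).choose j = (p + r).choose r := by
  induction r with
  | zero => simp
  | succ r ih =>
    rw [Finset.sum_range_succ, ih, show p + (r + 1) - 1 = p + r by omega,
      show p + (r + 1) = p + r + 1 by omega, Nat.choose_succ_succ]

/-- The hockey-stick identity with `p = n - m` and `j = m - l`. The case `r = m` normalizes the
weights; the general case splits the coefficient of a monomial with exponent `r` at `k₀`. -/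
lemma sum_choose_sub_one_of_le {m n r : ℕ} (hmn : m ≤ n) (hr : r ≤ m) :
    ∑ l ∈ range (m + 1), (if m - l ≤ r then (n - l - 1).choose (m - l) else 0) =
      (n - m + r).choose r := by
  rw [← sum_range_choose_sub_one, ← Finset.sum_range_reflect, ← Finset.sum_filter]
  refine Finset.sum_congr_of_eq_on_inter ?_ ?_ ?_
  · intro j hj hj'
    simp only [Finset.mem_filter, Finset.mem_range] at hj hj'
    omega
  · intro j hj hj'
    simp only [Finset.mem_filter, Finset.mem_range] at hj hj'
    omega
  · intro j hj hj'
    simp only [Finset.mem_filter, Finset.mem_range] at hj hj'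
    congr 1 <;> omega

lemma sum_weight {m n : ℕ} (hmn : m ≤ n) : ∑ l ∈ range (m + 1), weight n m l = 1 := by
  have h := sum_choose_sub_one_of_le hmn le_rfl
  simp only [Nat.sub_le, if_true, Nat.sub_add_cancel hmn] at h
  simp only [weight]
  rw [← Finset.sum_div, ← Nat.cast_sum, h, div_self]
  exact_mod_cast (Nat.choose_pos hmn).ne'

variable {ι : Type*} [Fintype ι] [DecidableEq ι]

/-- As `c k₀ = 1`, raising the exponent at `k₀` by `m - l` leaves a monomial unchanged and lifts
degree `l` to degree `m`. -/
lemma completeHomogeneous_eq_sum_of_le {c : ι → ℝ} {k₀ : ι} (hc : c k₀ = 1) {l m : ℕ}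
    (hl : l ≤ m) :
    completeHomogeneous c univ l =
      ∑ d ∈ univ.piAntidiag m, if m - l ≤ d k₀ then ∏ k, c k ^ d k else 0 := by
  rw [← Finset.sum_filter, completeHomogeneous]
  refine Finset.sum_bij' (fun d _ => d + Pi.single k₀ (m - l))
    (fun d _ => d - Pi.single k₀ (m - l)) ?_ ?_ ?_ ?_ ?_
  · intro d hd
    rw [mem_piAntidiag] at hd
    rw [Finset.mem_filter, mem_piAntidiag]
    refine ⟨⟨?_, fun _ _ => Finset.mem_univ _⟩, by simp⟩
    simp only [Pi.add_apply, Finset.sum_add_distrib, hd.1, Finset.sum_pi_single']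
    simp
    omega
  · intro d hd
    rw [Finset.mem_filter, mem_piAntidiag] at hd
    rw [mem_piAntidiag]
    refine ⟨?_, fun _ _ => Finset.mem_univ _⟩
    have h1 : ∑ k, (d - Pi.single k₀ (m - l) : ι → ℕ) k +
        ∑ k, Pi.single (M := fun _ => ℕ) k₀ (m - l) k = m := by
      rw [← Finset.sum_add_distrib, ← hd.1.1]
      refine Finset.sum_congr rfl fun k _ => ?_
      by_cases hk : k = k₀
      · subst hk
        simp only [Pi.sub_apply, Pi.single_eq_same]
        have := hd.2
        omega
      · simp [hk]
    have h2 : ∑ k, Pi.single (M := fun _ => ℕ) k₀ (m - l) k = m - l := by simp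
    change ∑ k, (d - Pi.single k₀ (m - l) : ι → ℕ) k = l
    omega
  · intro d _
    funext k
    simp
  · intro d hd
    rw [Finset.mem_filter] at hd
    funext k
    by_cases hk : k = k₀
    · subst hk
      simp only [Pi.add_apply, Pi.sub_apply, Pi.single_eq_same]
      have := hd.2
      omega
    · simp [hk]
  · intro d _
    refine Finset.prod_congr rfl fun k _ => ?_
    by_cases hk : k = k₀
    · subst hk
      simp [hc]
    · simp [hk]

/-- The combinatorial core. A multiplicity vector `d` occurs for `m! / ∏ d_k!` labellings; the
factorials cancel except at `k₀`, leaving `n! C(n-m+d_{k₀}, d_{k₀}) / C(n, m)`, which the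
hockey-stick identity splits into weights. -/
lemma sum_prod_mul_factorial_valueCount {m n : ℕ} (hmn : m ≤ n) {c : ι → ℝ} {k₀ : ι}
    (hc : c k₀ = 1) :
    ∑ κ : Fin m → ι, (∏ i, c (κ i)) *
        ∏ k, ((valueCount κ k + if k = k₀ then n - m else 0).factorial : ℝ) =
      n.factorial * ∑ l ∈ range (m + 1), weight n m l * completeHomogeneous c univ l := by
  have hterm : ∀ d ∈ (univ : Finset ι).piAntidiag m,
      (Nat.multinomial univ d : ℝ) *
        ((∏ k, c k ^ d k) * ∏ k, ((d k + if k = k₀ then n - m else 0).factorial : ℝ)) =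
      n.factorial * ∑ l ∈ range (m + 1), weight n m l *
        (if m - l ≤ d k₀ then ∏ k, c k ^ d k else 0) := by
    intro d hd
    rw [mem_piAntidiag] at hd
    have hr : d k₀ ≤ m := by
      rw [← hd.1]
      exact Finset.single_le_sum (f := d) (fun _ _ => Nat.zero_le _) (Finset.mem_univ k₀)
    have h1 : (∏ k, (d k + if k = k₀ then n - m else 0).factorial) * (d k₀).factorial =
        (∏ k, (d k).factorial) * (d k₀ + (n - m)).factorial := by
      rw [← Finset.mul_prod_erase univ _ (Finset.mem_univ k₀),
        ← Finset.mul_prod_erase univ (fun k => (d k).factorial) (Finset.mem_univ k₀), if_pos rfl]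
      rw [Finset.prod_congr rfl fun k hk => by rw [if_neg (Finset.ne_of_mem_erase hk), add_zero]]
      ring
    have h2 := Nat.multinomial_spec univ d
    rw [hd.1] at h2
    have h3 : (n - m + d k₀).choose (d k₀) * (d k₀).factorial * (n - m).factorial =
        (d k₀ + (n - m)).factorial := by
      have := Nat.choose_mul_factorial_mul_factorial (show d k₀ ≤ n - m + d k₀ by omega)
      rw [Nat.add_sub_cancel] at this
      rw [this, add_comm]
    have h4 := Nat.choose_mul_factorial_mul_factorial hmn
    have h5 := sum_choose_sub_one_of_le hmn hr
    have h6 : ∑ l ∈ range (m + 1), weight n m l * (if m - l ≤ d k₀ then ∏ k, c k ^ d k else 0) =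
        ((n - m + d k₀).choose (d k₀) : ℝ) / n.choose m * ∏ k, c k ^ d k := by
      rw [← h5, Nat.cast_sum, Finset.sum_div, Finset.sum_mul]
      refine Finset.sum_congr rfl fun l _ => ?_
      rw [weight]
      split_ifs <;> simp
    rw [h6]
    have hC : (n.choose m : ℝ) ≠ 0 := by exact_mod_cast (Nat.choose_pos hmn).ne'
    have hd0 : ((d k₀).factorial : ℝ) ≠ 0 := by exact_mod_cast (Nat.factorial_pos _).ne'
    -- The common factor `(d k₀)!` avoids division in `ℕ`; it is cancelled in `h8`.
    have h7 : Nat.multinomial univ d * (∏ k, (d k + if k = k₀ then n - m else 0).factorial) *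
        n.choose m * (d k₀).factorial =
        n.factorial * (n - m + d k₀).choose (d k₀) * (d k₀).factorial := by
      calc _ = Nat.multinomial univ d * ((∏ k, (d k + if k = k₀ then n - m else 0).factorial) *
            (d k₀).factorial) * n.choose m := by ring
        _ = ((∏ k, (d k).factorial) * Nat.multinomial univ d) * (d k₀ + (n - m)).factorial *
            n.choose m := by rw [h1]; ring
        _ = _ := by rw [h2, ← h3, ← h4]; ring
    have h8 : (Nat.multinomial univ d : ℝ) *
        (∏ k, ((d k + if k = k₀ then n - m else 0).factorial : ℝ)) * n.choose m =
        n.factorial * (n - m + d k₀).choose (d k₀) := by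
      have := Nat.eq_of_mul_eq_mul_right (Nat.factorial_pos _) h7
      exact_mod_cast this
    field_simp
    linear_combination (∏ k, c k ^ d k) * h8
  have hsum := sum_valueCount (α := Fin m) (ι := ι) fun d => (∏ k, c k ^ d k) *
    ∏ k, ((d k + if k = k₀ then n - m else 0).factorial : ℝ)
  rw [Fintype.card_fin] at hsum
  simp only [prod_comp_eq_prod_pow_valueCount]
  rw [hsum, Finset.sum_congr rfl hterm, ← Finset.mul_sum, Finset.sum_comm]
  congr 1
  refine Finset.sum_congr rfl fun l hl => ?_
  rw [completeHomogeneous_eq_sum_of_le hc (Nat.lt_succ_iff.1 (Finset.mem_range.1 hl)),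
    Finset.mul_sum]

end Counting

/-! ### Densities of the alternative laws -/

section Densities

lemma lintegral_pi_prod {ι : Type*} [Fintype ι] {E : ι → Type*} [∀ i, MeasurableSpace (E i)]
    {μ : ∀ i, Measure (E i)} [∀ i, IsProbabilityMeasure (μ i)] {f : ∀ i, E i → ℝ≥0∞}
    (hf : ∀ i, Measurable (f i)) :
    ∫⁻ x, ∏ i, f i (x i) ∂(Measure.pi μ) = ∏ i, ∫⁻ x, f i x ∂(μ i) := by
  rw [ProbabilityTheory.lintegral_prod_eq_prod_lintegral_of_indepFun Finset.univ
    (fun i (x : ∀ i, E i) => f i (x i))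
    (ProbabilityTheory.iIndepFun_pi fun i => (hf i).aemeasurable)
    fun i => (hf i).comp (measurable_pi_apply i)]
  refine Finset.prod_congr rfl fun i _ => ?_
  exact (measurePreserving_eval μ i).lintegral_comp (hf i)

lemma pi_withDensity {ι : Type*} [Fintype ι] {E : ι → Type*} [∀ i, MeasurableSpace (E i)]
    {μ : ∀ i, Measure (E i)} [∀ i, IsProbabilityMeasure (μ i)] {f : ∀ i, E i → ℝ≥0∞}
    (hf : ∀ i, Measurable (f i)) [∀ i, SigmaFinite ((μ i).withDensity (f i))] :
    Measure.pi (fun i => (μ i).withDensity (f i)) =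
      (Measure.pi μ).withDensity fun x => ∏ i, f i (x i) := by
  refine Measure.pi_eq fun s hs => ?_
  rw [withDensity_apply _ (MeasurableSet.univ_pi hs),
    ← lintegral_indicator (MeasurableSet.univ_pi hs)]
  have h1 : ∀ x : ∀ i, E i, (Set.univ.pi s).indicator (fun x => ∏ i, f i (x i)) x =
      ∏ i, (s i).indicator (f i) (x i) := by
    intro x
    by_cases hx : x ∈ Set.univ.pi s
    · rw [Set.indicator_of_mem hx]
      exact Finset.prod_congr rfl fun i _ => (Set.indicator_of_mem (hx i trivial) _).symm
    · rw [Set.indicator_of_notMem hx]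
      simp only [Set.mem_univ_pi, not_forall] at hx
      obtain ⟨i, hi⟩ := hx
      exact (Finset.prod_eq_zero (Finset.mem_univ i) (Set.indicator_of_notMem hi _)).symm
  simp only [h1]
  rw [lintegral_pi_prod fun i => (hf i).indicator (hs i)]
  refine Finset.prod_congr rfl fun i _ => ?_
  rw [lintegral_indicator (hs i), withDensity_apply _ (hs i)]

lemma map_withDensity_comp {α β : Type*} [MeasurableSpace α] [MeasurableSpace β] {μ : Measure α}
    {g : α → β} (hg : Measurable g) {f : β → ℝ≥0∞} (hf : Measurable f) :
    (μ.withDensity (f ∘ g)).map g = (μ.map g).withDensity f := by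
  ext s hs
  rw [Measure.map_apply hg hs, withDensity_apply _ (hg hs), withDensity_apply _ hs,
    setLIntegral_map hs hf hg]
  rfl

variable {𝓧 𝓨 : Type*} [MeasurableSpace 𝓧] [MeasurableSpace 𝓨] {n m : ℕ}

lemma assemble_fst_apply (π : Fin m ↪ Fin n)
    (d : (Fin m → 𝓧 × 𝓨) × ({j : Fin n // j ∉ Set.range π} → 𝓧)) (i : Fin m) :
    (assemble π d).1 (π i) = (d.1 i).1 := by
  have h : π i ∈ Set.range π := ⟨i, rfl⟩
  have h2 : h.choose = i := π.injective h.choose_spec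
  simp only [assemble]
  rw [dif_pos h, h2]

lemma assemble_fst_of_notMem (π : Fin m ↪ Fin n)
    (d : (Fin m → 𝓧 × 𝓨) × ({j : Fin n // j ∉ Set.range π} → 𝓧)) (j : Fin n)
    (hj : j ∉ Set.range π) : (assemble π d).1 j = d.2 ⟨j, hj⟩ := by
  simp only [assemble]
  rw [dif_neg hj]

lemma prod_eq_prod_range_mul {M : Type*} [CommMonoid M] (π : Fin m ↪ Fin n) (f : Fin n → M)
    [Fintype {j : Fin n // j ∉ Set.range π}] :
    ∏ j, f j = (∏ i, f (π i)) * ∏ j : {j : Fin n // j ∉ Set.range π}, f j := by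
  classical
  rw [← Fintype.prod_subtype_mul_prod_subtype (fun j => j ∈ Set.range π) f]
  congr 1
  · convert (Fintype.prod_equiv (Equiv.ofInjective π π.injective) (fun i => f (π i))
      (fun j : {j // j ∈ Set.range π} => f j) fun _ => rfl).symm
  · congr!

/-- Arranging independent pairs with independent components yields the null law. -/
lemma map_assemble_prod (μ : Measure 𝓧) (ν : Measure 𝓨) [IsProbabilityMeasure μ]
    [IsProbabilityMeasure ν] (π : Fin m ↪ Fin n) :
    ((Measure.pi fun _ : Fin m => μ.prod ν).prod
      (Measure.pi fun _ : {j : Fin n // j ∉ Set.range π} => μ)).map (assemble π) =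
      (Measure.pi fun _ : Fin n => μ).prod (Measure.pi fun _ : Fin m => ν) := by
  symm
  refine Measure.prod_eq_generateFrom generateFrom_pi generateFrom_pi isPiSystem_pi isPiSystem_pi
    (Measure.FiniteSpanningSetsIn.pi fun _ => μ.toFiniteSpanningSetsIn)
    (Measure.FiniteSpanningSetsIn.pi fun _ => ν.toFiniteSpanningSetsIn) ?_
  rintro _ ⟨A, hA, rfl⟩ _ ⟨B, hB, rfl⟩
  have hA' : ∀ i, MeasurableSet (A i) := fun i => hA i trivial
  have hB' : ∀ i, MeasurableSet (B i) := fun i => hB i trivial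
  rw [Measure.map_apply (measurable_assemble π)
    ((MeasurableSet.univ_pi hA').prod (MeasurableSet.univ_pi hB'))]
  have hpre : assemble π ⁻¹' (Set.univ.pi A ×ˢ Set.univ.pi B) =
      (Set.univ.pi fun i => A (π i) ×ˢ B i) ×ˢ
        (Set.univ.pi fun j : {j : Fin n // j ∉ Set.range π} => A j) := by
    ext d
    simp only [Set.mem_preimage, Set.mem_prod, Set.mem_univ_pi]
    constructor
    · rintro ⟨h1, h2⟩
      refine ⟨fun i => ⟨?_, h2 i⟩, fun j => ?_⟩
      · rw [← assemble_fst_apply π d i]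
        exact h1 _
      · rw [← assemble_fst_of_notMem π d j j.2]
        exact h1 _
    · rintro ⟨h1, h2⟩
      refine ⟨fun j => ?_, fun i => (h1 i).2⟩
      by_cases hj : j ∈ Set.range π
      · obtain ⟨i, rfl⟩ := hj
        rw [assemble_fst_apply]
        exact (h1 i).1
      · rw [assemble_fst_of_notMem π d j hj]
        exact h2 ⟨j, hj⟩
  rw [hpre, Measure.prod_prod, Measure.pi_pi, Measure.pi_pi, Measure.pi_pi, Measure.pi_pi,
    prod_eq_prod_range_mul π]
  simp only [Measure.prod_prod, Finset.prod_mul_distrib]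
  ring

/-- The pairs `(X (π i), Y i)` of a data set. -/
def pairing (π : Fin m ↪ Fin n) (d : (Fin n → 𝓧) × (Fin m → 𝓨)) (i : Fin m) : 𝓧 × 𝓨 :=
  (d.1 (π i), d.2 i)

lemma pairing_assemble (π : Fin m ↪ Fin n)
    (d : (Fin m → 𝓧 × 𝓨) × ({j : Fin n // j ∉ Set.range π} → 𝓧)) :
    pairing π (assemble π d) = d.1 := by
  funext i
  rw [pairing, assemble_fst_apply]
  rfl

lemma measurable_pairing (π : Fin m ↪ Fin n) : Measurable (pairing (𝓧 := 𝓧) (𝓨 := 𝓨) π) := by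
  unfold pairing
  fun_prop

variable (P : Measure (𝓧 × 𝓨)) [IsProbabilityMeasure P]

instance : IsProbabilityMeasure (nullLaw P n m) := by
  unfold nullLaw
  infer_instance

/-- Under the null law the pairs selected by `π` are i.i.d. from the product of the marginals,
because the null law is itself assembled from such pairs and `pairing` recovers them. -/
lemma measurePreserving_pairing (π : Fin m ↪ Fin n) :
    MeasurePreserving (pairing π) (nullLaw P n m)
      (Measure.pi fun _ : Fin m => P.fst.prod P.snd) := by
  refine ⟨measurable_pairing π, ?_⟩
  rw [nullLaw, ← map_assemble_prod P.fst P.snd π,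
    Measure.map_map (measurable_pairing π) (measurable_assemble π)]
  have : pairing π ∘ assemble π = (Prod.fst : (Fin m → 𝓧 × 𝓨) × _ → _) :=
    funext (pairing_assemble π)
  rw [this]
  exact Measure.fst_prod

variable {P}

/-- The density of the pairs factors through `assemble π`, so it passes through the pushforward, and
`map_assemble_prod` identifies the reference measure. -/
lemma altLawGiven_eq_withDensity (hP : P ≪ P.fst.prod P.snd) (π : Fin m ↪ Fin n) :
    altLawGiven P π = (nullLaw P n m).withDensity
      fun d => ∏ i, P.rnDeriv (P.fst.prod P.snd) (pairing π d i) := by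
  have hℓ : Measurable (P.rnDeriv (P.fst.prod P.snd)) := Measure.measurable_rnDeriv _ _
  have hPd : (P.fst.prod P.snd).withDensity (P.rnDeriv (P.fst.prod P.snd)) = P :=
    Measure.withDensity_rnDeriv_eq _ _ hP
  have hsf : IsProbabilityMeasure
    ((P.fst.prod P.snd).withDensity (P.rnDeriv (P.fst.prod P.snd))) := by rw [hPd]; infer_instance
  have hpi : (Measure.pi fun _ : Fin m => P) =
      (Measure.pi fun _ : Fin m => P.fst.prod P.snd).withDensity
        fun z => ∏ i, P.rnDeriv (P.fst.prod P.snd) (z i) := by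
    rw [← pi_withDensity fun _ => hℓ, hPd]
  have hprod : Measurable fun z : Fin m → 𝓧 × 𝓨 => ∏ i, P.rnDeriv (P.fst.prod P.snd) (z i) := by
    fun_prop
  have hprod' : Measurable fun d : (Fin n → 𝓧) × (Fin m → 𝓨) =>
      ∏ i, P.rnDeriv (P.fst.prod P.snd) (pairing π d i) := hprod.comp (measurable_pairing π)
  have hcomp : (fun d : (Fin m → 𝓧 × 𝓨) × ({j : Fin n // j ∉ Set.range π} → 𝓧) =>
      ∏ i, P.rnDeriv (P.fst.prod P.snd) (d.1 i)) =
      (fun d : (Fin n → 𝓧) × (Fin m → 𝓨) =>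
        ∏ i, P.rnDeriv (P.fst.prod P.snd) (pairing π d i)) ∘ assemble π := by
    funext d
    rw [Function.comp_apply, pairing_assemble]
  rw [altLawGiven, hpi, prod_withDensity_left hprod, hcomp,
    map_withDensity_comp (measurable_assemble π) hprod', map_assemble_prod]
  rfl

lemma altLaw_eq_withDensity (hP : P ≪ P.fst.prod P.snd) :
    altLaw P n m = (nullLaw P n m).withDensity fun d =>
      (Fintype.card (Fin m ↪ Fin n) : ℝ≥0∞)⁻¹ *
        ∑ π : Fin m ↪ Fin n, ∏ i, P.rnDeriv (P.fst.prod P.snd) (pairing π d i) := by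
  have hℓ : Measurable (P.rnDeriv (P.fst.prod P.snd)) := Measure.measurable_rnDeriv _ _
  have hm : ∀ π : Fin m ↪ Fin n, Measurable fun d : (Fin n → 𝓧) × (Fin m → 𝓨) =>
      ∏ i, P.rnDeriv (P.fst.prod P.snd) (pairing π d i) := fun π => by
    unfold pairing
    fun_prop
  ext s hs
  rw [altLaw, withDensity_apply _ hs,
    lintegral_const_mul _ (Finset.measurable_sum _ fun π _ => hm π),
    lintegral_finsetSum _ fun π _ => hm π, Measure.smul_apply, Measure.finsetSum_apply, smul_eq_mul]
  congr 1
  refine Finset.sum_congr rfl fun π _ => ?_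
  rw [altLawGiven_eq_withDensity hP, withDensity_apply _ hs]

lemma altLaw_absolutelyContinuous (hP : P ≪ P.fst.prod P.snd) :
    altLaw P n m ≪ nullLaw P n m := by
  rw [altLaw_eq_withDensity hP]
  exact withDensity_absolutelyContinuous _ _

lemma fullLikelihoodRatio_ae_eq (hP : P ≪ P.fst.prod P.snd) :
    fullLikelihoodRatio P n m =ᵐ[nullLaw P n m] fun d =>
      (Fintype.card (Fin m ↪ Fin n) : ℝ)⁻¹ *
        ∑ π : Fin m ↪ Fin n, ∏ i, likelihoodRatio P (pairing π d i) := by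
  have hℓ : Measurable (P.rnDeriv (P.fst.prod P.snd)) := Measure.measurable_rnDeriv _ _
  have hm : ∀ π : Fin m ↪ Fin n, Measurable fun d : (Fin n → 𝓧) × (Fin m → 𝓨) =>
      ∏ i, P.rnDeriv (P.fst.prod P.snd) (pairing π d i) := fun π => by
    unfold pairing
    fun_prop
  -- Almost sure finiteness lets `toReal` commute with the sum over injections.
  have hfin : ∀ᵐ d ∂(nullLaw P n m), ∀ π : Fin m ↪ Fin n,
      ∏ i, P.rnDeriv (P.fst.prod P.snd) (pairing π d i) < ∞ := by
    rw [ae_all_iff]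
    intro π
    have hprod : Measurable fun z : Fin m → 𝓧 × 𝓨 => ∏ i, P.rnDeriv (P.fst.prod P.snd) (z i) := by
      fun_prop
    refine ae_lt_top (hm π) ?_
    rw [(measurePreserving_pairing P π).lintegral_comp hprod, lintegral_pi_prod fun _ => hℓ]
    refine ENNReal.prod_ne_top fun i _ => ?_
    exact (Measure.lintegral_rnDeriv_lt_top _ _).ne
  have hrn : (altLaw P n m).rnDeriv (nullLaw P n m) =ᵐ[nullLaw P n m] fun d =>
      (Fintype.card (Fin m ↪ Fin n) : ℝ≥0∞)⁻¹ *
        ∑ π : Fin m ↪ Fin n, ∏ i, P.rnDeriv (P.fst.prod P.snd) (pairing π d i) := by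
    rw [altLaw_eq_withDensity hP]
    exact Measure.rnDeriv_withDensity _
      ((Finset.measurable_sum _ fun π _ => hm π).const_mul _)
  filter_upwards [hrn, hfin] with d h1 h2
  rw [fullLikelihoodRatio, h1, ENNReal.toReal_mul, ENNReal.toReal_inv, ENNReal.toReal_natCast,
    ENNReal.toReal_sum fun π _ => (h2 π).ne]
  simp only [ENNReal.toReal_prod]
  rfl

end Densities

/-! ### Products of a kernel along an injection -/

section KernelProduct

open scoped RealInnerProductSpace

variable {𝓧 𝓨 : Type*} [MeasurableSpace 𝓧] [MeasurableSpace 𝓨] {n m : ℕ}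
  (P : Measure (𝓧 × 𝓨)) [IsProbabilityMeasure P]

lemma measurePreserving_pairing_apply (π : Fin m ↪ Fin n) (i : Fin m) :
    MeasurePreserving (fun d => pairing π d i) (nullLaw P n m) (P.fst.prod P.snd) :=
  (measurePreserving_eval (fun _ : Fin m => P.fst.prod P.snd) i).comp
    (measurePreserving_pairing P π)

variable {P}

lemma prod_pairing_congr {K K' : 𝓧 × 𝓨 → ℝ} (h : K =ᵐ[P.fst.prod P.snd] K') (π : Fin m ↪ Fin n) :
    (fun d => ∏ i, K (pairing π d i)) =ᵐ[nullLaw P n m] fun d => ∏ i, K' (pairing π d i) := by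
  have h1 : ∀ᵐ d ∂(nullLaw P n m), ∀ i, K (pairing π d i) = K' (pairing π d i) := by
    rw [ae_all_iff]
    intro i
    exact (measurePreserving_pairing_apply P π i).quasiMeasurePreserving.ae h
  filter_upwards [h1] with d hd
  exact Finset.prod_congr rfl fun i _ => hd i

lemma integrable_prod_pairing {K : 𝓧 × 𝓨 → ℝ} (hK : Integrable K (P.fst.prod P.snd))
    (π : Fin m ↪ Fin n) : Integrable (fun d => ∏ i, K (pairing π d i)) (nullLaw P n m) :=
  (measurePreserving_pairing P π).integrable_comp_of_integrable
    (Integrable.fintype_prod (f := fun _ : Fin m => K) fun _ => hK)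

lemma integral_prod_pairing {K : 𝓧 × 𝓨 → ℝ} (hK : Integrable K (P.fst.prod P.snd))
    (π : Fin m ↪ Fin n) :
    ∫ d, ∏ i, K (pairing π d i) ∂(nullLaw P n m) = (∫ z, K z ∂(P.fst.prod P.snd)) ^ m := by
  have hmp := measurePreserving_pairing P π
  have hinteg : Integrable (fun z : Fin m → 𝓧 × 𝓨 => ∏ i, K (z i))
      (Measure.pi fun _ : Fin m => P.fst.prod P.snd) :=
    Integrable.fintype_prod (f := fun _ : Fin m => K) fun _ => hK
  rw [← hmp.map_eq] at hinteg
  have h1 := integral_map hmp.measurable.aemeasurable hinteg.aestronglyMeasurable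
  rw [hmp.map_eq, integral_fintype_prod_eq_pow, Fintype.card_fin] at h1
  exact h1.symm

lemma memLp_prod_pairing {K : 𝓧 × 𝓨 → ℝ} (hK : MemLp K 2 (P.fst.prod P.snd))
    (π : Fin m ↪ Fin n) : MemLp (fun d => ∏ i, K (pairing π d i)) 2 (nullLaw P n m) := by
  have hinteg := integrable_prod_pairing (hK.integrable (by norm_num)) π
  refine (memLp_two_iff_integrable_sq hinteg.aestronglyMeasurable).2 ?_
  simp only [← Finset.prod_pow]
  exact integrable_prod_pairing (K := fun z => K z ^ 2) hK.integrable_sq π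

/-- The function `(x, y) ↦ ∏ i, K (x (π i), y i)` for a square-integrable kernel `K`. -/
def kernelProduct (π : Fin m ↪ Fin n) (K : Lp ℝ 2 (P.fst.prod P.snd)) : Lp ℝ 2 (nullLaw P n m) :=
  (memLp_prod_pairing (Lp.memLp K) π).toLp _

lemma kernelProduct_ae_eq (π : Fin m ↪ Fin n) (K : Lp ℝ 2 (P.fst.prod P.snd)) :
    kernelProduct π K =ᵐ[nullLaw P n m] fun d => ∏ i, K (pairing π d i) :=
  MemLp.coeFn_toLp _

lemma inner_kernelProduct (π : Fin m ↪ Fin n) (K K' : Lp ℝ 2 (P.fst.prod P.snd)) :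
    ⟪kernelProduct π K, kernelProduct π K'⟫ = ⟪K, K'⟫ ^ m := by
  have hinteg : Integrable (fun z => K z * K' z) (P.fst.prod P.snd) :=
    (Lp.memLp K).integrable_mul (Lp.memLp K')
  rw [inner_eq_integral_mul, inner_eq_integral_mul, ← integral_prod_pairing hinteg π]
  refine integral_congr_ae ?_
  filter_upwards [kernelProduct_ae_eq π K, kernelProduct_ae_eq π K'] with d h1 h2
  rw [h1, h2, ← Finset.prod_mul_distrib]

/-- The map is not linear in `K`, but expanding the squared distance with `inner_kernelProduct`
gives a polynomial in inner products that vanishes at `K' = K`. -/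
lemma continuous_kernelProduct (π : Fin m ↪ Fin n) :
    Continuous (kernelProduct (P := P) π) := by
  rw [continuous_iff_continuousAt]
  intro K
  rw [ContinuousAt, tendsto_iff_norm_sub_tendsto_zero]
  have h1 : ∀ K', ‖kernelProduct π K' - kernelProduct π K‖ =
      √(⟪K', K'⟫ ^ m - 2 * ⟪K', K⟫ ^ m + ⟪K, K⟫ ^ m) := by
    intro K'
    rw [← inner_kernelProduct π, ← inner_kernelProduct π, ← inner_kernelProduct π,
      real_inner_self_eq_norm_sq, real_inner_self_eq_norm_sq, ← norm_sub_sq_real,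
      Real.sqrt_sq (norm_nonneg _)]
  simp only [h1]
  have h2 : Continuous fun K' : Lp ℝ 2 (P.fst.prod P.snd) =>
      √(⟪K', K'⟫ ^ m - 2 * ⟪K', K⟫ ^ m + ⟪K, K⟫ ^ m) := by fun_prop
  have h3 := h2.tendsto K
  rwa [show ⟪K, K⟫ ^ m - 2 * ⟪K, K⟫ ^ m + ⟪K, K⟫ ^ m = 0 by ring, Real.sqrt_zero] at h3

/-- The average of `kernelProduct π K` over all injections `π`. -/
def averagedKernel (n m : ℕ) (K : Lp ℝ 2 (P.fst.prod P.snd)) : Lp ℝ 2 (nullLaw P n m) :=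
  (Fintype.card (Fin m ↪ Fin n) : ℝ)⁻¹ • ∑ π : Fin m ↪ Fin n, kernelProduct π K

lemma continuous_averagedKernel : Continuous (averagedKernel (P := P) n m) := by
  have h : Continuous fun K : Lp ℝ 2 (P.fst.prod P.snd) =>
      ∑ π : Fin m ↪ Fin n, kernelProduct π K :=
    continuous_finsetSum _ fun π _ => continuous_kernelProduct π
  exact h.const_smul (Fintype.card (Fin m ↪ Fin n) : ℝ)⁻¹

lemma averagedKernel_ae_eq (K : Lp ℝ 2 (P.fst.prod P.snd)) {K' : 𝓧 × 𝓨 → ℝ}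
    (hK : K =ᵐ[P.fst.prod P.snd] K') :
    averagedKernel n m K =ᵐ[nullLaw P n m] fun d =>
      (Fintype.card (Fin m ↪ Fin n) : ℝ)⁻¹ * ∑ π : Fin m ↪ Fin n, ∏ i, K' (pairing π d i) := by
  have h1 : ∀ᵐ d ∂(nullLaw P n m), ∀ π : Fin m ↪ Fin n,
      kernelProduct π K d = ∏ i, K' (pairing π d i) := by
    rw [ae_all_iff]
    intro π
    exact (kernelProduct_ae_eq π K).trans (prod_pairing_congr hK π)
  filter_upwards [h1, Lp.coeFn_smul (Fintype.card (Fin m ↪ Fin n) : ℝ)⁻¹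
    (∑ π : Fin m ↪ Fin n, kernelProduct π K),
    Lp.coeFn_finsetSum (Finset.univ : Finset (Fin m ↪ Fin n)) fun π => kernelProduct π K]
    with d h2 h3 h4
  rw [averagedKernel, h3, Pi.smul_apply, h4, smul_eq_mul]
  simp [h2]

lemma fullLikelihoodRatio_ae_eq_averagedKernel (hP : P ≪ P.fst.prod P.snd)
    (hL : MemLp (likelihoodRatio P) 2 (P.fst.prod P.snd)) :
    fullLikelihoodRatio P n m =ᵐ[nullLaw P n m] averagedKernel n m (hL.toLp _) :=
  (fullLikelihoodRatio_ae_eq hP).trans (averagedKernel_ae_eq _ hL.coeFn_toLp).symm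

lemma integral_sq_eq_norm_sq {γ : Type*} [MeasurableSpace γ] {ρ : Measure γ} {f : γ → ℝ}
    {g : Lp ℝ 2 ρ} (h : f =ᵐ[ρ] g) : ∫ z, f z ^ 2 ∂ρ = ‖g‖ ^ 2 := by
  rw [← real_inner_self_eq_norm_sq, inner_eq_integral_mul]
  refine integral_congr_ae ?_
  filter_upwards [h] with z hz
  rw [hz, sq]

end KernelProduct

/-! ### Kernels of finite rank -/

section FiniteRank

variable {𝓧 𝓨 : Type*} [MeasurableSpace 𝓧] [MeasurableSpace 𝓨] {n m : ℕ}

lemma integral_prod_orthonormal {γ ι κ : Type*} [MeasurableSpace γ] [Fintype κ] [DecidableEq ι]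
    {μ : Measure γ} [SigmaFinite μ] {u : ι → γ → ℝ}
    (hu : ∀ k l, ∫ x, u k x * u l x ∂μ = if k = l then 1 else 0) (η η' : κ → ι) :
    ∫ x : κ → γ, (∏ j, u (η j) (x j)) * ∏ j, u (η' j) (x j) ∂(Measure.pi fun _ => μ) =
      if η = η' then 1 else 0 := by
  simp only [← Finset.prod_mul_distrib]
  rw [integral_fintype_prod_eq_prod (fun j x => u (η j) x * u (η' j) x)]
  simp only [hu]
  rw [Finset.prod_ite_zero]
  simp [funext_iff]

variable {ι : Type*} [Fintype ι] [DecidableEq ι]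
  {P : Measure (𝓧 × 𝓨)} [IsProbabilityMeasure P]
  {u : ι → 𝓧 → ℝ} {v : ι → 𝓨 → ℝ} {c : ι → ℝ} {k₀ : ι}

/-- Unpaired coordinates contribute the factor `u k₀ = 1`, so the product in `x` may run over all of
`Fin n` with the extended labelling. -/
lemma prod_pairing_finiteRank (hu0 : ∀ x, u k₀ x = 1) (π : Fin m ↪ Fin n)
    (d : (Fin n → 𝓧) × (Fin m → 𝓨)) :
    ∏ i, (∑ k, c k * (u k (pairing π d i).1 * v k (pairing π d i).2)) =
      ∑ κ : Fin m → ι, (∏ i, c (κ i)) *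
        ((∏ j, u (extendLabel k₀ κ π j) (d.1 j)) * ∏ i, v (κ i) (d.2 i)) := by
  rw [Finset.prod_univ_sum, Fintype.piFinset_univ]
  refine Finset.sum_congr rfl fun κ _ => ?_
  rw [Finset.prod_mul_distrib, Finset.prod_mul_distrib]
  congr 2
  classical
  rw [prod_eq_prod_range_mul π]
  have h1 : ∏ j : {j : Fin n // j ∉ Set.range π}, u (extendLabel k₀ κ π j) (d.1 j) = 1 := by
    refine Finset.prod_eq_one fun j _ => ?_
    rw [extendLabel, Function.extend_apply' _ _ _ fun ⟨i, hi⟩ => j.2 ⟨i, hi⟩, hu0]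
  rw [h1, mul_one]
  refine Finset.prod_congr rfl fun i _ => ?_
  rw [extendLabel, π.injective.extend_apply]
  rfl

/-- The correlation of the products of a finite rank kernel along two injections. -/
lemma integral_prod_pairing_finiteRank
    (hum : ∀ k, MemLp (u k) 2 P.fst) (hvm : ∀ k, MemLp (v k) 2 P.snd)
    (hu : ∀ k l, ∫ x, u k x * u l x ∂P.fst = if k = l then 1 else 0)
    (hv : ∀ k l, ∫ y, v k y * v l y ∂P.snd = if k = l then 1 else 0)
    (hu0 : ∀ x, u k₀ x = 1) (π π' : Fin m ↪ Fin n) :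
    ∫ d, (∏ i, (∑ k, c k * (u k (pairing π d i).1 * v k (pairing π d i).2))) *
        ∏ i, (∑ k, c k * (u k (pairing π' d i).1 * v k (pairing π' d i).2)) ∂(nullLaw P n m) =
      ∑ κ : Fin m → ι, (∏ i, c (κ i) ^ 2) *
        if extendLabel k₀ κ π = extendLabel k₀ κ π' then 1 else 0 := by
  simp only [prod_pairing_finiteRank hu0, Finset.sum_mul_sum]
  have hU : ∀ η η' : Fin n → ι, Integrable (fun x : Fin n → 𝓧 =>
      (∏ j, u (η j) (x j)) * ∏ j, u (η' j) (x j)) (Measure.pi fun _ => P.fst) := by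
    intro η η'
    simp only [← Finset.prod_mul_distrib]
    exact Integrable.fintype_prod (f := fun j x => u (η j) x * u (η' j) x)
      fun j => (hum _).integrable_mul (hum _)
  have hV : ∀ κ κ' : Fin m → ι, Integrable (fun y : Fin m → 𝓨 =>
      (∏ i, v (κ i) (y i)) * ∏ i, v (κ' i) (y i)) (Measure.pi fun _ => P.snd) := by
    intro κ κ'
    simp only [← Finset.prod_mul_distrib]
    exact Integrable.fintype_prod (f := fun i y => v (κ i) y * v (κ' i) y)
      fun i => (hvm _).integrable_mul (hvm _)
  have hre : ∀ (κ κ' : Fin m → ι) (d : (Fin n → 𝓧) × (Fin m → 𝓨)),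
      (∏ i, c (κ i)) * ((∏ j, u (extendLabel k₀ κ π j) (d.1 j)) * ∏ i, v (κ i) (d.2 i)) *
        ((∏ i, c (κ' i)) * ((∏ j, u (extendLabel k₀ κ' π' j) (d.1 j)) * ∏ i, v (κ' i) (d.2 i))) =
      ((∏ i, c (κ i)) * ∏ i, c (κ' i)) *
        (((∏ j, u (extendLabel k₀ κ π j) (d.1 j)) * ∏ j, u (extendLabel k₀ κ' π' j) (d.1 j)) *
          ((∏ i, v (κ i) (d.2 i)) * ∏ i, v (κ' i) (d.2 i))) := fun κ κ' d => by ring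
  simp only [hre]
  have hinteg : ∀ κ κ' : Fin m → ι, Integrable (fun d : (Fin n → 𝓧) × (Fin m → 𝓨) =>
      ((∏ i, c (κ i)) * ∏ i, c (κ' i)) *
        (((∏ j, u (extendLabel k₀ κ π j) (d.1 j)) * ∏ j, u (extendLabel k₀ κ' π' j) (d.1 j)) *
          ((∏ i, v (κ i) (d.2 i)) * ∏ i, v (κ' i) (d.2 i)))) (nullLaw P n m) :=
    fun κ κ' => ((hU _ _).mul_prod (hV _ _)).const_mul _
  rw [integral_finsetSum _ fun κ _ => integrable_finsetSum _ fun κ' _ => hinteg κ κ']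
  refine Finset.sum_congr rfl fun κ _ => ?_
  -- Orthonormality in `y` leaves only `κ' = κ`; the `x`-integral then compares the two extended
  -- labellings.
  rw [integral_finsetSum _ fun κ' _ => hinteg κ κ', Finset.sum_eq_single κ]
  · rw [integral_const_mul, nullLaw, integral_prod_mul
      (fun x : Fin n → 𝓧 => (∏ j, u (extendLabel k₀ κ π j) (x j)) *
        ∏ j, u (extendLabel k₀ κ π' j) (x j))
      (fun y : Fin m → 𝓨 => (∏ i, v (κ i) (y i)) * ∏ i, v (κ i) (y i)),
      integral_prod_orthonormal hu, integral_prod_orthonormal hv, if_pos rfl, mul_one,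
      ← Finset.prod_mul_distrib]
    simp only [sq]
  · intro κ' _ hne
    rw [integral_const_mul, nullLaw, integral_prod_mul
      (fun x : Fin n → 𝓧 => (∏ j, u (extendLabel k₀ κ π j) (x j)) *
        ∏ j, u (extendLabel k₀ κ' π' j) (x j))
      (fun y : Fin m → 𝓨 => (∏ i, v (κ i) (y i)) * ∏ i, v (κ' i) (y i)),
      integral_prod_orthonormal hv, if_neg hne.symm, mul_zero, mul_zero]
  · simp

/-- The second moment of the averaged product of a kernel of finite rank. -/
lemma norm_sq_averagedKernel_finiteRank (hmn : m ≤ n) {K : Lp ℝ 2 (P.fst.prod P.snd)}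
    (hK : K =ᵐ[P.fst.prod P.snd] fun z => ∑ k, c k * (u k z.1 * v k z.2))
    (hum : ∀ k, MemLp (u k) 2 P.fst) (hvm : ∀ k, MemLp (v k) 2 P.snd)
    (hu : ∀ k l, ∫ x, u k x * u l x ∂P.fst = if k = l then 1 else 0)
    (hv : ∀ k l, ∫ y, v k y * v l y ∂P.snd = if k = l then 1 else 0)
    (hu0 : ∀ x, u k₀ x = 1) (hc : c k₀ = 1) :
    ‖averagedKernel n m K‖ ^ 2 = ∑ l ∈ Finset.range (m + 1),
      weight n m l * completeHomogeneous (fun k => c k ^ 2) Finset.univ l := by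
  have hinner : ∀ π π' : Fin m ↪ Fin n, inner ℝ (kernelProduct π K) (kernelProduct π' K) =
      ∑ κ : Fin m → ι, (∏ i, c (κ i) ^ 2) *
        if extendLabel k₀ κ π = extendLabel k₀ κ π' then (1 : ℝ) else 0 := by
    intro π π'
    rw [inner_eq_integral_mul,
      ← integral_prod_pairing_finiteRank hum hvm hu hv hu0 π π']
    refine integral_congr_ae ?_
    filter_upwards [(kernelProduct_ae_eq π K).trans (prod_pairing_congr hK π),
      (kernelProduct_ae_eq π' K).trans (prod_pairing_congr hK π')] with d h1 h2
    rw [h1, h2]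
  have hN : (Fintype.card (Fin m ↪ Fin n) : ℝ) ≠ 0 := by
    have : Nonempty (Fin m ↪ Fin n) := ⟨Fin.castLEEmb hmn⟩
    exact_mod_cast Fintype.card_ne_zero
  have hn : (n.factorial : ℝ) ≠ 0 := by exact_mod_cast n.factorial_ne_zero
  have hmain := sum_prod_mul_factorial_valueCount hmn (c := fun k => c k ^ 2) (k₀ := k₀)
    (by simp [hc])
  -- Multiplying by `n!` brings both sides to the form of the two counting lemmas.
  rw [← mul_right_inj' hn, ← hmain, averagedKernel, norm_smul, mul_pow,
    ← real_inner_self_eq_norm_sq (∑ π : Fin m ↪ Fin n, kernelProduct π K), sum_inner]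
  simp only [inner_sum, hinner]
  have hswap : ∑ π : Fin m ↪ Fin n, ∑ π' : Fin m ↪ Fin n, ∑ κ : Fin m → ι, (∏ i, c (κ i) ^ 2) *
      (if extendLabel k₀ κ π = extendLabel k₀ κ π' then (1 : ℝ) else 0) =
      ∑ κ : Fin m → ι, (∏ i, c (κ i) ^ 2) * ∑ π : Fin m ↪ Fin n, ∑ π' : Fin m ↪ Fin n,
        (if extendLabel k₀ κ π = extendLabel k₀ κ π' then (1 : ℝ) else 0) := by
    rw [Finset.sum_congr rfl fun π _ => Finset.sum_comm, Finset.sum_comm]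
    simp only [Finset.mul_sum]
  rw [hswap, Finset.mul_sum, Finset.mul_sum]
  refine Finset.sum_congr rfl fun κ _ => ?_
  have hcount := sum_extendLabel_eq (n := n) k₀ κ
  rw [norm_inv, Real.norm_natCast]
  field_simp
  linear_combination (∏ i, c (κ i) ^ 2) * hcount

end FiniteRank

/-! ### The second moment -/

section SecondMoment

open scoped RealInnerProductSpace

variable {𝓧 𝓨 : Type*} [MeasurableSpace 𝓧] [MeasurableSpace 𝓨] {n m : ℕ}

/-- The constant function `1` in `L²`. -/
def oneLp {γ : Type*} [MeasurableSpace γ] (ρ : Measure γ) [IsFiniteMeasure ρ] : Lp ℝ 2 ρ :=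
  (memLp_const (1 : ℝ)).toLp _

lemma oneLp_ae_eq {γ : Type*} [MeasurableSpace γ] (ρ : Measure γ) [IsFiniteMeasure ρ] :
    oneLp ρ =ᵐ[ρ] fun _ => (1 : ℝ) :=
  MemLp.coeFn_toLp _

lemma norm_oneLp {γ : Type*} [MeasurableSpace γ] (ρ : Measure γ) [IsProbabilityMeasure ρ] :
    ‖oneLp ρ‖ = 1 := by
  have h := integral_sq_eq_norm_sq (oneLp_ae_eq ρ).symm
  simp only [one_pow, integral_const, probReal_univ, smul_eq_mul, mul_one] at h
  rw [← sq_eq_sq₀ (norm_nonneg _) zero_le_one, ← h, one_pow]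

lemma inner_oneLp {γ : Type*} [MeasurableSpace γ] (ρ : Measure γ) [IsFiniteMeasure ρ]
    (f : Lp ℝ 2 ρ) : ⟪f, oneLp ρ⟫ = ∫ z, f z ∂ρ := by
  rw [inner_eq_integral_mul]
  refine integral_congr_ae ?_
  filter_upwards [oneLp_ae_eq ρ] with z hz
  rw [hz, mul_one]

variable {P : Measure (𝓧 × 𝓨)} [IsProbabilityMeasure P]

lemma inner_likelihoodRatio_tensor (hP : P ≪ P.fst.prod P.snd)
    (hL : MemLp (likelihoodRatio P) 2 (P.fst.prod P.snd)) (f : Lp ℝ 2 P.fst) (g : Lp ℝ 2 P.snd) :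
    ⟪hL.toLp _, tensor f g⟫ = ∫ z, f z.1 * g z.2 ∂P := by
  rw [inner_eq_integral_mul, ← integral_rnDeriv_smul hP]
  refine integral_congr_ae ?_
  filter_upwards [hL.coeFn_toLp, tensor_ae_eq f g] with z h1 h2
  rw [h1, h2]
  rfl

lemma integral_comp_fst (f : Lp ℝ 2 P.fst) : ∫ z, f z.1 ∂P = ∫ x, f x ∂P.fst :=
  (integral_map measurable_fst.aemeasurable (Lp.aestronglyMeasurable f)).symm

lemma integral_comp_snd (g : Lp ℝ 2 P.snd) : ∫ z, g z.2 ∂P = ∫ y, g y ∂P.snd :=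
  (integral_map measurable_snd.aemeasurable (Lp.aestronglyMeasurable g)).symm

/-- Tested against `f`, both sides are the integral of `f(x)` under `P`, whose first marginal is
`P.fst`. -/
lemma likelihoodRatioOperator_oneLp (hP : P ≪ P.fst.prod P.snd)
    (hL : MemLp (likelihoodRatio P) 2 (P.fst.prod P.snd)) :
    likelihoodRatioOperator P hL (oneLp P.snd) = oneLp P.fst := by
  refine ext_inner_left ℝ fun f => ?_
  rw [likelihoodRatioOperator, ← inner_kernel_tensor, inner_likelihoodRatio_tensor hP,
    inner_oneLp, ← integral_comp_fst]
  refine integral_congr_ae ?_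
  have hq : Measure.QuasiMeasurePreserving Prod.snd P P.snd :=
    (measurable_snd.measurePreserving P).quasiMeasurePreserving
  filter_upwards [hq.ae (oneLp_ae_eq P.snd)] with z hz
  rw [hz, mul_one]

lemma adjoint_likelihoodRatioOperator_oneLp (hP : P ≪ P.fst.prod P.snd)
    (hL : MemLp (likelihoodRatio P) 2 (P.fst.prod P.snd)) :
    ContinuousLinearMap.adjoint (likelihoodRatioOperator P hL) (oneLp P.fst) = oneLp P.snd := by
  refine ext_inner_left ℝ fun g => ?_
  rw [ContinuousLinearMap.adjoint_inner_right, real_inner_comm, likelihoodRatioOperator,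
    ← inner_kernel_tensor, inner_likelihoodRatio_tensor hP, inner_oneLp, ← integral_comp_snd]
  refine integral_congr_ae ?_
  have hq : Measure.QuasiMeasurePreserving Prod.fst P P.fst :=
    (measurable_fst.measurePreserving P).quasiMeasurePreserving
  filter_upwards [hq.ae (oneLp_ae_eq P.fst)] with z hz
  rw [hz, one_mul]

lemma oneLp_mem_gramEigenspace (hP : P ≪ P.fst.prod P.snd)
    (hL : MemLp (likelihoodRatio P) 2 (P.fst.prod P.snd)) :
    oneLp P.snd ∈ gramEigenspace (likelihoodRatioOperator P hL) 1 := by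
  rw [Module.End.mem_eigenspace_iff, one_smul]
  change ContinuousLinearMap.adjoint (likelihoodRatioOperator P hL)
    (likelihoodRatioOperator P hL (oneLp P.snd)) = oneLp P.snd
  rw [likelihoodRatioOperator_oneLp hP, adjoint_likelihoodRatioOperator_oneLp hP]

lemma integral_mul_of_orthonormal {γ ι : Type*} [MeasurableSpace γ] {ρ : Measure γ} [DecidableEq ι]
    {u : ι → Lp ℝ 2 ρ} (hu : Orthonormal ℝ u) {u' : ι → γ → ℝ} (h : ∀ k, u k =ᵐ[ρ] u' k)
    (k l : ι) : ∫ x, u' k x * u' l x ∂ρ = if k = l then 1 else 0 := by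
  rw [← orthonormal_iff_ite.1 hu k l, inner_eq_integral_mul]
  refine integral_congr_ae ?_
  filter_upwards [h k, h l] with x h1 h2
  rw [h1, h2]

/-- The second moment for the truncation of a singular value expansion that contains the constant
functions. -/
lemma norm_sq_averagedKernel_partialSum (hmn : m ≤ n) {ι : Type*} [DecidableEq ι]
    {u : ι → Lp ℝ 2 P.fst} {v : ι → Lp ℝ 2 P.snd} {c : ι → ℝ} {k₀ : ι} (hu : Orthonormal ℝ u)
    (hv : Orthonormal ℝ v) (hu0 : u k₀ = oneLp P.fst) (hc : c k₀ = 1) {s : Finset ι}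
    (hs : k₀ ∈ s) :
    ‖averagedKernel n m (∑ k ∈ s, c k • tensor (u k) (v k))‖ ^ 2 =
      ∑ l ∈ Finset.range (m + 1), weight n m l * completeHomogeneous (fun k => c k ^ 2) s l := by
  -- The finite rank computation needs `u k₀ = 1` at every point, so the representative is changed
  -- on a null set.
  let u' : ι → 𝓧 → ℝ := fun k => if k = k₀ then fun _ => 1 else u k
  have hu' : ∀ k, u k =ᵐ[P.fst] u' k := by
    intro k
    by_cases hk : k = k₀
    · subst hk
      simp only [u', if_true]
      rw [hu0]
      exact oneLp_ae_eq _
    · simp only [u', if_neg hk]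
      rfl
  have hK : (∑ k ∈ s, c k • tensor (u k) (v k) : Lp ℝ 2 (P.fst.prod P.snd)) =ᵐ[P.fst.prod P.snd]
      fun z => ∑ k : s, c k * (u' k z.1 * v k z.2) := by
    have h1 : ∀ᵐ z ∂(P.fst.prod P.snd), ∀ k : s,
        (c k • tensor (u k) (v k) : Lp ℝ 2 (P.fst.prod P.snd)) z = c k * (u' k z.1 * v k z.2) := by
      rw [ae_all_iff]
      intro k
      filter_upwards [Lp.coeFn_smul (c k) (tensor (u k) (v k)), tensor_ae_eq (u k) (v k),
        Measure.quasiMeasurePreserving_fst.ae (hu' k)] with z h1 h2 h3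
      rw [h1, Pi.smul_apply, h2, h3, smul_eq_mul]
    filter_upwards [h1, Lp.coeFn_finsetSum s fun k => c k • tensor (u k) (v k)] with z h2 h3
    rw [h3, Finset.sum_apply, ← Finset.sum_coe_sort]
    exact Finset.sum_congr rfl fun k _ => h2 k
  have hmain := norm_sq_averagedKernel_finiteRank (n := n) hmn (k₀ := (⟨k₀, hs⟩ : s))
    (u := fun k : s => u' k) (v := fun k : s => v k) (c := fun k : s => c k) hK
    (fun k => (memLp_congr_ae (hu' k)).1 (Lp.memLp _)) (fun k => Lp.memLp _)
    (fun k l => by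
      rw [integral_mul_of_orthonormal hu hu']
      simp only [Subtype.coe_inj])
    (fun k l => by
      rw [integral_mul_of_orthonormal hv fun k => Filter.EventuallyEq.rfl]
      simp only [Subtype.coe_inj])
    (fun x => by simp [u']) hc
  rw [hmain]
  refine Finset.sum_congr rfl fun l _ => ?_
  congr 1
  have hmap := completeHomogeneous_map (Function.Embedding.subtype (· ∈ s)) (fun k => c k ^ 2)
    Finset.univ l
  rw [Finset.univ_eq_attach, Finset.attach_map_val] at hmap
  exact hmap.symm

/-- The second moment of the averaged likelihood ratio through the singular values. -/
lemma multipliable_factor_and_norm_sq_averagedKernel (hP : P ≪ P.fst.prod P.snd)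
    (hL : MemLp (likelihoodRatio P) 2 (P.fst.prod P.snd)) (hmn : m ≤ n) {lam : ℕ → ℝ}
    (hlam : IsSingularValueSeq (likelihoodRatioOperator P hL) lam) :
    Multipliable (factor lam) ∧ ‖averagedKernel n m (hL.toLp _)‖ ^ 2 =
      ∑ l ∈ Finset.range (m + 1), weight n m l * productCoeff lam l := by
  set T := likelihoodRatioOperator P hL
  have hTc : IsCompactOperator T :=
    isCompactOperator_kernelOperator (stronglyMeasurable_likelihoodRatio P) hL
  obtain ⟨v, hv, hvmem, ⟨k₀, hk₀, hvk₀⟩, hker⟩ := exists_singularVectors hTc hlam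
    (norm_oneLp P.snd) (oneLp_mem_gramEigenspace hP hL)
  -- Left singular vectors; they are orthonormal because `⟪T v_k, T v_l⟫ = λ_l² ⟪v_k, v_l⟫`.
  let u : {k // 0 < lam k} → Lp ℝ 2 P.fst := fun k => (lam k)⁻¹ • T (v k)
  have hne : ∀ k : {k // 0 < lam k}, lam k ≠ 0 := fun k => k.2.ne'
  have hT : ∀ k, T (v k) = lam k • u k := fun k => by
    simp only [u]
    rw [smul_inv_smul₀ (hne k)]
  have hnorm : ∀ k, ‖T (v k)‖ ^ 2 = lam k ^ 2 := fun k => by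
    rw [norm_sq_map_of_mem_gramEigenspace (hvmem k), hv.1 k]
    ring
  have hu : Orthonormal ℝ u := by
    refine ⟨fun k => ?_, fun k l hkl => ?_⟩
    · have h1 : ‖T (v k)‖ = lam k := (sq_eq_sq₀ (norm_nonneg _) k.2.le).1 (hnorm k)
      simp only [u]
      rw [norm_smul, norm_inv, Real.norm_of_nonneg k.2.le, h1, inv_mul_cancel₀ (hne k)]
    · change ⟪(lam k)⁻¹ • T (v k), (lam l)⁻¹ • T (v l)⟫ = 0
      rw [real_inner_smul_left, real_inner_smul_right,
        inner_map_map_of_mem_gramEigenspace (v k) (hvmem l), hv.2 hkl]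
      simp
  have hu0 : u k₀ = oneLp P.fst := by
    simp only [u]
    rw [hk₀, hvk₀, inv_one, one_smul]
    exact likelihoodRatioOperator_oneLp hP hL
  have hsum : Summable fun k => lam k ^ 2 := by
    have h1 := summable_norm_sq_kernelOperator (stronglyMeasurable_likelihoodRatio P) hL hv
    have h2 : Summable ((fun k => lam k ^ 2) ∘ (Subtype.val : {k | 0 < lam k} → ℕ)) :=
      h1.congr fun k => hnorm k
    refine (summable_subtype_iff_indicator.1 h2).congr fun k => ?_
    by_cases hk : 0 < lam k
    · exact Set.indicator_of_mem (s := {k | 0 < lam k}) hk _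
    · rw [Set.indicator_of_notMem (s := {k | 0 < lam k}) hk,
        le_antisymm (not_lt.1 hk) (hlam.nonneg k)]
      simp
  have hmul := multipliable_factor hsum
  refine ⟨hmul, ?_⟩
  have hexp : HasSum (fun k : {k // 0 < lam k} => lam k • tensor (u k) (v k)) (hL.toLp _) :=
    hasSum_kernel hu hv hT hker
  have hlim1 := ((continuous_averagedKernel (P := P) (n := n) (m := m)).norm.pow
    2).continuousAt.tendsto.comp hexp
  have hlim2 : Filter.Tendsto (fun s : Finset {k // 0 < lam k} => ∑ l ∈ Finset.range (m + 1),
      weight n m l * completeHomogeneous (fun k : {k // 0 < lam k} => lam k ^ 2) s l)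
      Filter.atTop (nhds (∑ l ∈ Finset.range (m + 1), weight n m l * productCoeff lam l)) :=
    tendsto_finsetSum _ fun l _ =>
      (tendsto_completeHomogeneous hlam.nonneg hmul l).const_mul _
  -- Both limits run over finite sets of singular indices; the truncated formula applies once the
  -- set contains `k₀`.
  refine tendsto_nhds_unique hlim1 (hlim2.congr' ?_)
  filter_upwards [Filter.eventually_ge_atTop {k₀}] with s hs
  exact (norm_sq_averagedKernel_partialSum hmn (c := fun k : {k // 0 < lam k} => lam k) hu hv hu0
    hk₀ (hs (Finset.mem_singleton_self k₀))).symm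

end SecondMoment

end BrokenSample

end

theorem mainTheorem2 {𝓧 𝓨 : Type*} [MeasurableSpace 𝓧] [MeasurableSpace 𝓨]
    (P : Measure (𝓧 × 𝓨)) [IsProbabilityMeasure P]
    (hP : P ≪ P.fst.prod P.snd)
    (hL : MemLp (BrokenSample.likelihoodRatio P) 2 (P.fst.prod P.snd))
    (n m : ℕ) (hmn : m ≤ n) :
    -- the likelihood ratio of the two hypotheses exists and is square integrable
    BrokenSample.altLaw P n m ≪ BrokenSample.nullLaw P n m ∧
    MemLp (BrokenSample.fullLikelihoodRatio P n m) 2 (BrokenSample.nullLaw P n m) ∧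
    -- the weights sum to one
    ∑ l ∈ Finset.range (m + 1), BrokenSample.weight n m l = 1 ∧
    -- the singular values exist, and the second moment is expressed through them
    (∃! lam : ℕ → ℝ,
      BrokenSample.IsSingularValueSeq (BrokenSample.likelihoodRatioOperator P hL) lam) ∧
    ∀ lam : ℕ → ℝ,
      BrokenSample.IsSingularValueSeq (BrokenSample.likelihoodRatioOperator P hL) lam →
      Multipliable (BrokenSample.factor lam) ∧
      ∫ d, BrokenSample.fullLikelihoodRatio P n m d ^ 2 ∂(BrokenSample.nullLaw P n m) =
        ∑ l ∈ Finset.range (m + 1),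
          BrokenSample.weight n m l * BrokenSample.productCoeff lam l := by
  refine ⟨BrokenSample.altLaw_absolutelyContinuous hP, ?_, BrokenSample.sum_weight hmn, ?_, ?_⟩
  · exact (memLp_congr_ae
      (BrokenSample.fullLikelihoodRatio_ae_eq_averagedKernel hP hL)).2 (Lp.memLp _)
  · exact BrokenSample.existsUnique_isSingularValueSeq
      (BrokenSample.isCompactOperator_kernelOperator
        (BrokenSample.stronglyMeasurable_likelihoodRatio P) hL)
      fun hv => BrokenSample.summable_norm_sq_kernelOperator
        (BrokenSample.stronglyMeasurable_likelihoodRatio P) hL hv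
  · intro lam hlam
    rw [BrokenSample.integral_sq_eq_norm_sq
      (BrokenSample.fullLikelihoodRatio_ae_eq_averagedKernel hP hL)]
    exact BrokenSample.multipliable_factor_and_norm_sq_averagedKernel hP hL hmn hlam
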